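/- Let $k$ be a field of characteristic different from $2$. Let $B=k\langle y_1,y_2\rangle/(y_1^2,\,y_2^2,\,y_1y_2+y_2y_1)$ and let $A=B\rtimes k\langle g\rangle$ be the skew group algebra of $B$ by the cyclic group $\langle g\rangle$ of order $2$ acting by $gy_ig^{-1}=-y_i$ $(i=1,2)$. Regard $A$ as a bialgebra with comultiplication $\Delta(g)=g\otimes g$, $\Delta(y_i)=1\otimes y_i+y_i\otimes g$ and counit $\varepsilon(g)=1$, $\varepsilon(y_i)=0$, and let $k$ also denote the trivial module, on which $A$ acts through $\varepsilon$. For $A$-modules $M$ and $N$ put $\operatorname{Ext}^*_A(M,N)=\bigoplus_{n\ge 0}\operatorname{Ext}^n_A(M,N)$; then $\operatorname{Ext}^*_A(k,k)$ is a $k$-algebra under the Yoneda product. The exact functor $-\otimes_k M$, together with $k\otimes_k M\cong M$, induces a ring homomorphism $\psi_M:\operatorname{Ext}^*_A(k,k)\to\operatorname{Ext}^*_A(M,M)$, and $\operatorname{Ext}^*_A(M,N)$ is a module over $\operatorname{Ext}^*_A(k,k)$ by letting $\zeta$ act as Yoneda composition with $\psi_M(\zeta)$, that is, $\alpha\mapsto\alpha\circ\psi_M(\zeta)$.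 Then $\operatorname{Ext}^*_A(k,k)$ is a finitely generated $k$-algebra, and for all finitely generated $A$-modules $M$ and $N$ the module $\operatorname{Ext}^*_A(M,N)$ is finitely generated over $\operatorname{Ext}^*_A(k,k)$. -/

import Mathlib

universe u

namespace ExtFG

section Alg
open scoped TensorProduct

/-- The defining relations `y₀² = y₁² = 0`, `y₀ y₁ + y₁ y₀ = 0` on the free algebra `k⟨y₀, y₁⟩`.
The two generators are indexed by `Fin 2`. -/
inductive ExtRel (k : Type u) [Field k] : FreeAlgebra k (Fin 2) → FreeAlgebra k (Fin 2) → Prop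
  | sq (i : Fin 2) : ExtRel k (FreeAlgebra.ι k i * FreeAlgebra.ι k i) 0
  | anticomm : ExtRel k (FreeAlgebra.ι k 0 * FreeAlgebra.ι k 1 + FreeAlgebra.ι k 1 * FreeAlgebra.ι k 0) 0

/-- The algebra `B = k⟨y₀, y₁⟩ / (y₀², y₁², y₀ y₁ + y₁ y₀)`. -/
def AlgB (k : Type u) [Field k] : Type u := RingQuot (ExtRel k)

namespace AlgB
variable (k : Type u) [Field k]

noncomputable instance : Ring (AlgB k) := inferInstanceAs (Ring (RingQuot (ExtRel k)))
noncomputable instance : Algebra k (AlgB k) := inferInstanceAs (Algebra k (RingQuot (ExtRel k)))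

/-- The generator `yᵢ` of `B`. -/
noncomputable def y (i : Fin 2) : AlgB k := RingQuot.mkAlgHom k (ExtRel k) (FreeAlgebra.ι k i)

theorem y_sq (i : Fin 2) : y k i * y k i = 0 := by
  have h := RingQuot.mkAlgHom_rel k (ExtRel.sq (k := k) i)
  rw [map_mul, map_zero] at h
  exact h

theorem y_anticomm : y k 0 * y k 1 + y k 1 * y k 0 = 0 := by
  have h := RingQuot.mkAlgHom_rel k (ExtRel.anticomm (k := k))
  rw [map_add, map_mul, map_mul, map_zero] at h
  exact h

variable {k} {C : Type*} [Ring C] [Algebra k C]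

/-- Universal property of `B`. -/
noncomputable def lift (f : Fin 2 → C) (hsq : ∀ i, f i * f i = 0)
    (hanti : f 0 * f 1 + f 1 * f 0 = 0) : AlgB k →ₐ[k] C :=
  RingQuot.liftAlgHom k ⟨FreeAlgebra.lift k f, by
    rintro _ _ (i | _)
    · simp [hsq]
    · simp [hanti]⟩

@[simp] theorem lift_y (f : Fin 2 → C) (hsq : ∀ i, f i * f i = 0)
    (hanti : f 0 * f 1 + f 1 * f 0 = 0) (i : Fin 2) :
    lift (k := k) f hsq hanti (y k i) = f i := by
  unfold lift y
  erw [RingQuot.liftAlgHom_mkAlgHom_apply]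
  simp

theorem algHom_ext {f g : AlgB k →ₐ[k] C} (h : ∀ i, f (y k i) = g (y k i)) : f = g := by
  refine RingQuot.ringQuot_ext' k f g ?_
  refine FreeAlgebra.hom_ext ?_
  funext i
  exact h i

variable (k)

/-- The algebra automorphism `yᵢ ↦ -yᵢ` of `B`. -/
noncomputable def sgn : AlgB k →ₐ[k] AlgB k :=
  lift (fun i => - y k i) (fun i => by simp [y_sq]) (by simp [y_anticomm])

@[simp] theorem sgn_y (i : Fin 2) : sgn k (y k i) = - y k i := lift_y ..

theorem sgn_sq : sgn k * sgn k = 1 := algHom_ext fun i => by simp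

end AlgB

/-- The cyclic group `⟨g⟩` of order two, written multiplicatively. -/
abbrev C2 : Type := Multiplicative (ZMod 2)

namespace C2
/-- The generator of the group of order two. -/
def g : C2 := Multiplicative.ofAdd 1

/-- The homomorphism `g ↦ x` to a monoid, for an element with `x² = 1`. -/
def homOfSq {M : Type*} [Monoid M] (x : M) (hx : x * x = 1) : C2 →* M where
  toFun u := x ^ (Multiplicative.toAdd u).val
  map_one' := by simp
  map_mul' u v := by
    rw [← pow_add, toAdd_mul, ZMod.val_add]
    exact (pow_eq_pow_mod _ (by rw [pow_two, hx])).symm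

theorem homOfSq_g {M : Type*} [Monoid M] (x : M) (hx : x * x = 1) : homOfSq x hx g = x :=
  pow_one x

theorem g_mul_g : g * g = 1 := rfl

theorem eq_one_or_g (u : C2) : u = 1 ∨ u = g := by
  revert u; decide
end C2

namespace AlgB
variable (k : Type u) [Field k]

/-- The homomorphism through which `⟨g⟩` acts on `B`: the generator acts by `yᵢ ↦ -yᵢ`. -/
noncomputable def actionHom : C2 →* (AlgB k →ₐ[k] AlgB k) := C2.homOfSq (sgn k) (sgn_sq k)

/-- The action of `⟨g⟩` on `B` by algebra automorphisms, with `g • yᵢ = -yᵢ`. -/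
noncomputable instance : MulSemiringAction C2 (AlgB k) where
  smul u b := actionHom k u b
  one_smul b := by change actionHom k 1 b = b; simp
  mul_smul u v b := by
    change actionHom k (u * v) b = actionHom k u (actionHom k v b); simp
  smul_zero u := map_zero (actionHom k u)
  smul_add u := map_add (actionHom k u)
  smul_one u := map_one (actionHom k u)
  smul_mul u := map_mul (actionHom k u)

theorem g_smul (b : AlgB k) : C2.g • b = sgn k b := by
  change actionHom k C2.g b = _
  rw [actionHom, C2.homOfSq_g]

instance : SMulCommClass C2 k (AlgB k) where
  smul_comm u c b := map_smul (actionHom k u) c b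

end AlgB

/-- The algebra `A = B ⋊ k⟨g⟩`: the skew group algebra of `B` by the group of order two, so that
`g² = 1` and `g yᵢ g⁻¹ = -yᵢ`. -/
abbrev AlgA (k : Type u) [Field k] : Type u := SkewMonoidAlgebra (AlgB k) C2

namespace AlgA
variable (k : Type u) [Field k]

/-- The inclusion of `B` in `A`. -/
noncomputable def incl : AlgB k →ₐ[k] AlgA k where
  toFun b := SkewMonoidAlgebra.single 1 b
  map_one' := rfl
  map_mul' a b := by simp [SkewMonoidAlgebra.single_mul_single]
  map_zero' := by simp
  map_add' a b := SkewMonoidAlgebra.single_add ..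
  commutes' c := rfl

theorem incl_apply (b : AlgB k) : incl k b = SkewMonoidAlgebra.single 1 b := rfl

/-- The element `yᵢ` of `A`. -/
noncomputable def y (i : Fin 2) : AlgA k := incl k (AlgB.y k i)

/-- The element `g` of `A`. -/
noncomputable def g : AlgA k := SkewMonoidAlgebra.single C2.g 1

theorem y_sq (i : Fin 2) : y k i * y k i = 0 := by
  rw [y, ← map_mul, AlgB.y_sq, map_zero]

theorem y_anticomm : y k 0 * y k 1 + y k 1 * y k 0 = 0 := by
  simp only [y, ← map_mul, ← map_add, AlgB.y_anticomm, map_zero]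

theorem g_sq : g k * g k = 1 := by
  simp [g, SkewMonoidAlgebra.single_mul_single, C2.g_mul_g]

theorem g_mul_incl (b : AlgB k) : g k * incl k b = incl k (AlgB.sgn k b) * g k := by
  simp [g, incl_apply, SkewMonoidAlgebra.single_mul_single, AlgB.g_smul]

theorem g_mul_y (i : Fin 2) : g k * y k i = - (y k i * g k) := by
  rw [y, g_mul_incl, AlgB.sgn_y, map_neg, neg_mul]

variable {k} {C : Type*} [Ring C] [Algebra k C]

/-- Universal property of `A`. -/
noncomputable def lift (f : Fin 2 → C) (c : C) (hsq : ∀ i, f i * f i = 0)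
    (hanti : f 0 * f 1 + f 1 * f 0 = 0) (hc : c * c = 1) (hcf : ∀ i, c * f i = - (f i * c)) :
    AlgA k →ₐ[k] C :=
  SkewMonoidAlgebra.liftNCAlgHom (AlgB.lift f hsq hanti) (C2.homOfSq c hc) (by
    have key : ∀ x : AlgB k, AlgB.lift f hsq hanti (AlgB.sgn k x) =
        c * AlgB.lift f hsq hanti x * c := by
      let conj : C →ₐ[k] C :=
        { toFun := fun x => c * x * c
          map_one' := by simp [hc]
          map_mul' := fun x z => by
            calc c * (x * z) * c = c * x * 1 * z * c := by simp [mul_assoc]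
              _ = _ := by rw [← hc]; simp [mul_assoc]
          map_zero' := by simp
          map_add' := fun x z => by simp [mul_add, add_mul]
          commutes' := fun r => by
            rw [← Algebra.commutes, mul_assoc, hc, mul_one] }
      intro x
      refine DFunLike.congr_fun (f := (AlgB.lift f hsq hanti).comp (AlgB.sgn k))
        (g := conj.comp (AlgB.lift f hsq hanti)) (AlgB.algHom_ext fun i => ?_) x
      simp [conj, hcf]; simp [mul_assoc, hc]
    intro x u
    rcases C2.eq_one_or_g u with rfl | rfl
    · simp
    · rw [AlgB.g_smul, C2.homOfSq_g, key, mul_assoc, hc, mul_one])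

section
variable (f : Fin 2 → C) (c : C) (hsq : ∀ i, f i * f i = 0)
    (hanti : f 0 * f 1 + f 1 * f 0 = 0) (hc : c * c = 1) (hcf : ∀ i, c * f i = - (f i * c))

@[simp] theorem lift_y (i : Fin 2) : lift (k := k) f c hsq hanti hc hcf (y k i) = f i := by
  change SkewMonoidAlgebra.liftNC _ _ (SkewMonoidAlgebra.single _ _) = _
  rw [SkewMonoidAlgebra.liftNC_single]
  simp

@[simp] theorem lift_g : lift (k := k) f c hsq hanti hc hcf (g k) = c := by
  change SkewMonoidAlgebra.liftNC _ _ (SkewMonoidAlgebra.single _ _) = _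
  rw [SkewMonoidAlgebra.liftNC_single]
  simp [C2.homOfSq_g]
end

theorem algHom_ext {f f' : AlgA k →ₐ[k] C} (hy : ∀ i, f (y k i) = f' (y k i))
    (hg : f (g k) = f' (g k)) : f = f' := by
  have hB : f.comp (incl k) = f'.comp (incl k) := AlgB.algHom_ext hy
  apply AlgHom.ext
  intro a
  induction a using SkewMonoidAlgebra.induction_on with
  | zero => simp
  | single u b =>
    have : SkewMonoidAlgebra.single u b = incl k b * SkewMonoidAlgebra.single u (1 : AlgB k) := by
      simp [incl_apply, SkewMonoidAlgebra.single_mul_single]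
    rw [this, map_mul, map_mul]
    congr 1
    · exact DFunLike.congr_fun hB b
    · rcases C2.eq_one_or_g u with rfl | rfl
      · exact (map_one f).trans (map_one f').symm
      · exact hg
  | add a b ha hb => rw [map_add, map_add, ha, hb]

variable (k)

/-- The counit `ε(yᵢ) = 0`, `ε(g) = 1`. -/
noncomputable def counitHom : AlgA k →ₐ[k] k :=
  lift (fun _ => 0) 1 (by simp) (by simp) (by simp) (by simp)

/-- The comultiplication `Δ(yᵢ) = 1 ⊗ yᵢ + yᵢ ⊗ g`, `Δ(g) = g ⊗ g`. -/
noncomputable def comulHom : AlgA k →ₐ[k] AlgA k ⊗[k] AlgA k :=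
  lift (fun i => 1 ⊗ₜ y k i + y k i ⊗ₜ g k) (g k ⊗ₜ g k)
    (fun i => by
      simp [mul_add, add_mul, y_sq, g_mul_y, TensorProduct.tmul_neg])
    (by
      have h1 := congrArg (fun t => (1 : AlgA k) ⊗ₜ[k] t) (y_anticomm k)
      have h2 := congrArg (fun t => t ⊗ₜ[k] (1 : AlgA k)) (y_anticomm k)
      simp only [TensorProduct.tmul_add, TensorProduct.add_tmul, TensorProduct.tmul_zero,
        TensorProduct.zero_tmul] at h1 h2
      simp only [mul_add, add_mul, Algebra.TensorProduct.tmul_mul_tmul, one_mul, mul_one, g_sq,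
        g_mul_y, TensorProduct.tmul_neg]
      generalize (1 : AlgA k) ⊗ₜ[k] (y k 0 * y k 1) = a at *
      generalize (1 : AlgA k) ⊗ₜ[k] (y k 1 * y k 0) = a' at *
      rw [eq_neg_of_add_eq_zero_left h1, eq_neg_of_add_eq_zero_left h2]
      abel)
    (by simp [g_sq, Algebra.TensorProduct.one_def])
    (fun i => by simp [mul_add, add_mul, g_mul_y, TensorProduct.tmul_neg, TensorProduct.neg_tmul,
      add_comm])

/-- The bialgebra structure of `A` given by `Δ` and `ε`. -/
noncomputable instance : Bialgebra k (AlgA k) :=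
  Bialgebra.ofAlgHom (comulHom k) (counitHom k)
    (algHom_ext (fun i => by
      simp [comulHom, TensorProduct.tmul_add, TensorProduct.add_tmul, add_assoc,
        Algebra.TensorProduct.one_def]) (by simp [comulHom]))
    (algHom_ext (fun i => by simp [comulHom, counitHom]) (by simp [comulHom, counitHom]))
    (algHom_ext (fun i => by simp [comulHom, counitHom]) (by simp [comulHom, counitHom]))

end AlgA
end Alg

section ExtPart
open CategoryTheory Abelian
open scoped TensorProduct DirectSum

namespace ExtRingOf
variable {H : Type u} [Ring H]

theorem mk_comp {X Y Z : ModuleCat.{u} H} {a b c c' : ℕ} (α : Ext X Y a) (β : Ext Y Z b)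
    (h : a + b = c) (h' : a + b = c') :
    (GradedMonoid.mk c (α.comp β h) : GradedMonoid fun n : ℕ => Ext X Z n) =
      GradedMonoid.mk c' (α.comp β h') := by
  subst h; subst h'; rfl

/-- Yoneda product on `Ext*(X, X)`, in diagrammatic order: `α * β` is `α` followed by `β`. -/
noncomputable instance gmul (X : ModuleCat.{u} H) :
    GradedMonoid.GMul (fun n : ℕ => Ext X X n) where
  mul α β := α.comp β rfl

noncomputable instance gone (X : ModuleCat.{u} H) :
    GradedMonoid.GOne (fun n : ℕ => Ext X X n) where
  one := Ext.mk₀ (𝟙 X)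

noncomputable instance gmonoid (X : ModuleCat.{u} H) :
    GradedMonoid.GMonoid (fun n : ℕ => Ext X X n) where
  one_mul := by
    rintro ⟨n, α⟩
    refine (mk_comp (Ext.mk₀ (𝟙 X)) α _ (zero_add n)).trans ?_
    rw [Ext.mk₀_id_comp]
    rfl
  mul_one := by
    rintro ⟨n, α⟩
    refine (mk_comp α (Ext.mk₀ (𝟙 X)) _ (add_zero n)).trans ?_
    rw [Ext.comp_mk₀_id]
    rfl
  mul_assoc := by
    rintro ⟨n, α⟩ ⟨m, β⟩ ⟨p, γ⟩
    refine Eq.trans ?_ (mk_comp α (β.comp γ rfl) (add_assoc n m p).symm rfl)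
    rw [← Ext.comp_assoc α β γ rfl rfl rfl]
    rfl

/-- `Ext*(X, X)` is a graded ring under the Yoneda product. -/
noncomputable instance gring (X : ModuleCat.{u} H) : DirectSum.GRing (fun n : ℕ => Ext X X n) where
  mul_zero _ := Ext.comp_zero ..
  zero_mul _ := Ext.zero_comp ..
  mul_add _ _ _ := Ext.comp_add ..
  add_mul _ _ _ := Ext.add_comp ..
  natCast n := n • Ext.mk₀ (𝟙 X)
  natCast_zero := zero_smul ℕ _
  natCast_succ _ := succ_nsmul _ _
  intCast n := n • Ext.mk₀ (𝟙 X)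
  intCast_ofNat _ := natCast_zsmul _ _
  intCast_negSucc_ofNat _ := negSucc_zsmul _ _

variable (k : Type u) [Field k] [Algebra k H]

/-- `Ext*(X, X)` is a graded `k`-algebra when `H` is a `k`-algebra. -/
noncomputable instance galgebra (X : ModuleCat.{u} H) :
    DirectSum.GAlgebra k (fun n : ℕ => Ext X X n) where
  toFun := (smulAddHom k (Ext X X 0)).flip (Ext.mk₀ (𝟙 X))
  map_one := one_smul k (Ext.mk₀ (𝟙 X))
  map_mul r s := by
    refine Eq.trans ?_ (mk_comp (r • Ext.mk₀ (𝟙 X)) (s • Ext.mk₀ (𝟙 X)) (zero_add 0) rfl)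
    rw [Ext.smul_comp, Ext.mk₀_id_comp, smul_smul]
    rfl
  commutes := by
    rintro r ⟨n, α⟩
    refine (mk_comp (r • Ext.mk₀ (𝟙 X)) α _ (zero_add n)).trans
      (Eq.trans ?_ (mk_comp α (r • Ext.mk₀ (𝟙 X)) (add_zero n) rfl))
    rw [Ext.smul_comp, Ext.mk₀_id_comp, Ext.comp_smul, Ext.comp_mk₀_id]
  smul_def := by
    rintro r ⟨n, α⟩
    refine Eq.trans ?_ (mk_comp (r • Ext.mk₀ (𝟙 X)) α (zero_add n) rfl)
    rw [Ext.smul_comp, Ext.mk₀_id_comp]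
    rfl
end ExtRingOf

namespace BialgMod
variable (k : Type u) [Field k] {H : Type u} [Ring H] [Bialgebra k H]
open scoped ModuleCat

/-- The algebra map `H → H ⊗ H → End(X) ⊗ End(M) → End(X ⊗ M)` by which a bialgebra acts on the
tensor product of two modules: `h (x ⊗ m) = ∑ h₁ x ⊗ h₂ m`. -/
noncomputable def action (X M : ModuleCat.{u} H) : H →ₐ[k] Module.End k (X ⊗[k] M) :=
  (Module.endTensorEndAlgHom (R := k) (S := k) (A := k) (M := X) (N := M)).comp
    ((Algebra.TensorProduct.map (Algebra.lsmul k k X) (Algebra.lsmul k k M)).comp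
      (Bialgebra.comulAlgHom k H))

/-- The `H`-module `X ⊗ₖ M`. -/
noncomputable def tensorObj (X M : ModuleCat.{u} H) : ModuleCat.{u} H :=
  @ModuleCat.of H _ (X ⊗[k] M) _ (Module.compHom _ (action k X M).toRingHom)

variable {k} in
theorem map_aux {X Y M : ModuleCat.{u} H} (f : X →ₗ[k] Y) (hf : ∀ (h : H) x, f (h • x) = h • f x) (h : H)
   (t : X ⊗[k] M) : f.rTensor M (action k X M h t) = action k Y M h (f.rTensor M t) := by
  have : ∀ d : H ⊗[k] H, f.rTensor M (Module.endTensorEndAlgHom (R := k) (S := k) (A := k) (M := X) (N := M) (Algebra.TensorProduct.map (Algebra.lsmul k k X) (Algebra.lsmul k k M) d) t) =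
     Module.endTensorEndAlgHom (R := k) (S := k) (A := k) (M := Y) (N := M) (Algebra.TensorProduct.map (Algebra.lsmul k k Y) (Algebra.lsmul k k M) d) (f.rTensor M t) := by
    intro d
    induction d using TensorProduct.induction_on with
    | zero => simp
    | add a b ha hb => simp only [map_add, LinearMap.add_apply, ha, hb]
    | tmul a b =>
      induction t using TensorProduct.induction_on with
      | zero => simp
      | add a b ha hb => simp only [map_add,  ha, hb]
      | tmul x m =>
        rw [Algebra.TensorProduct.map_tmul, Algebra.TensorProduct.map_tmul, LinearMap.rTensor_tmul,
          Module.endTensorEndAlgHom_apply, Module.endTensorEndAlgHom_apply,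
          TensorProduct.AlgebraTensorModule.map_tmul, TensorProduct.AlgebraTensorModule.map_tmul,
          LinearMap.rTensor_tmul]
        simp only [Algebra.lsmul_coe, hf]
  exact this _

/-- The functor `- ⊗ₖ M` on `H`-modules. -/
noncomputable def tensorFunctor (M : ModuleCat.{u} H) : ModuleCat.{u} H ⥤ ModuleCat.{u} H where
  obj X := tensorObj k X M
  map {X Y} f := ModuleCat.ofHom (X := tensorObj k X M) (Y := tensorObj k Y M)
    { toFun := (f.hom.restrictScalars k).rTensor M
      map_add' := map_add _
      map_smul' := fun h t => map_aux (f.hom.restrictScalars k) (fun h x => f.hom.map_smul h x) h t }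
  map_id X := by
    ext t
    exact LinearMap.congr_fun (LinearMap.rTensor_id M X) t
  map_comp f g := by
    ext t
    exact LinearMap.congr_fun (LinearMap.rTensor_comp M (g.hom.restrictScalars k) (f.hom.restrictScalars k)) t

instance (M : ModuleCat.{u} H) : (tensorFunctor k M).Additive where
  map_add {X Y f g} := by
    ext t
    exact LinearMap.congr_fun (LinearMap.rTensor_add M (f.hom.restrictScalars k) (g.hom.restrictScalars k)) t

theorem exact (M : ModuleCat.{u} H) (S : ShortComplex (ModuleCat.{u} H)) (hS : S.ShortExact) :
    (S.map (tensorFunctor k M)).ShortExact := by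
  have := hS.mono_f
  have := hS.epi_g
  refine ShortComplex.ShortExact.mk' ?_ ?_ ?_
  · rw [ShortComplex.ShortExact.moduleCat_exact_iff_function_exact]
    exact Module.Flat.rTensor_exact (R := k) M (f := S.f.hom.restrictScalars k) (g := S.g.hom.restrictScalars k)
      ((ShortComplex.ShortExact.moduleCat_exact_iff_function_exact _).1 hS.exact)
  · rw [ModuleCat.mono_iff_injective]
    exact Module.Flat.rTensor_preserves_injective_linearMap (R := k) (M := M) (S.f.hom.restrictScalars k)
      ((ModuleCat.mono_iff_injective S.f).1 hS.mono_f)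
  · rw [ModuleCat.epi_iff_surjective]
    exact LinearMap.rTensor_surjective (R := k) M (g := S.g.hom.restrictScalars k)
      ((ModuleCat.epi_iff_surjective S.g).1 hS.epi_g)

theorem preserves (M : ModuleCat.{u} H) : Limits.PreservesFiniteLimits (tensorFunctor k M) ∧
    Limits.PreservesFiniteColimits (tensorFunctor k M) :=
  ((tensorFunctor k M).exact_tfae.out 0 3).1 (exact k M)

instance (M : ModuleCat.{u} H) : Limits.PreservesFiniteLimits (tensorFunctor k M) :=
  (preserves k M).1

instance (M : ModuleCat.{u} H) : Limits.PreservesFiniteColimits (tensorFunctor k M) :=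
  (preserves k M).2

variable (H) in
/-- The trivial module: `k` with `H` acting through the counit. -/
noncomputable def triv : ModuleCat.{u} H :=
  (ModuleCat.restrictScalars (Bialgebra.counitAlgHom k H).toRingHom).obj (ModuleCat.of k k)

/-- The trivial module as a `k`-vector space. -/
noncomputable def trivEquiv : triv k H ≃ₗ[k] k where
  toFun x := x
  invFun x := x
  map_add' _ _ := rfl
  map_smul' c x := by
    change Bialgebra.counitAlgHom k H (algebraMap k H c) * (show k from x) = c * (show k from x)
    rw [AlgHom.commutes]; rfl
  left_inv _ := rfl
  right_inv _ := rfl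

/-- The `k`-linear isomorphism `k ⊗ₖ M ≃ M`, `c ⊗ m ↦ c m`. -/
noncomputable def lid (M : ModuleCat.{u} H) : triv k H ⊗[k] M ≃ₗ[k] M :=
  (TensorProduct.congr (trivEquiv k) (LinearEquiv.refl k M)).trans (TensorProduct.lid k M)

theorem lid_tmul (M : ModuleCat.{u} H) (c : triv k H) (m : M) :
    lid k M (c ⊗ₜ m) = trivEquiv k c • m := rfl

theorem trivEquiv_smul (h : H) (c : triv k H) :
    trivEquiv k (h • c) = Coalgebra.counit (R := k) h * trivEquiv k c := rfl

theorem lid_action (M : ModuleCat.{u} H) (h : H) (t : triv k H ⊗[k] M) :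
    lid k M (action k (triv k H) M h t) = h • lid k M t := by
  have key : ∀ (d : H ⊗[k] H) (c : triv k H) (m : M), lid k M
      (Module.endTensorEndAlgHom (R := k) (S := k) (A := k) (M := triv k H) (N := M)
        (Algebra.TensorProduct.map (Algebra.lsmul k k (triv k H)) (Algebra.lsmul k k M) d)
          (c ⊗ₜ m)) =
      trivEquiv k c • (TensorProduct.lid k H ((Coalgebra.counit (R := k) (A := H)).rTensor H d) • m) := by
    intro d c m
    induction d using TensorProduct.induction_on with
    | zero => simp
    | add a b ha hb => simp only [map_add, LinearMap.add_apply, ha, hb, add_smul, smul_add]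
    | tmul a b =>
      rw [Algebra.TensorProduct.map_tmul, Module.endTensorEndAlgHom_apply,
        TensorProduct.AlgebraTensorModule.map_tmul, lid_tmul, LinearMap.rTensor_tmul,
        TensorProduct.lid_tmul, Algebra.lsmul_coe, Algebra.lsmul_coe, trivEquiv_smul, smul_assoc,
        smul_smul, mul_comm]
  induction t using TensorProduct.induction_on with
  | zero => simp
  | add a b ha hb => simp only [map_add, ha, hb, smul_add]
  | tmul c m =>
    refine (key (Coalgebra.comul h) c m).trans ?_
    rw [Coalgebra.rTensor_counit_comul, TensorProduct.lid_tmul, one_smul, lid_tmul, smul_comm]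

/-- The isomorphism `k ⊗ₖ M ≅ M` of `H`-modules. -/
noncomputable def lidIso (M : ModuleCat.{u} H) : (tensorFunctor k M).obj (triv k H) ≅ M :=
  LinearEquiv.toModuleIso (X₁ := tensorObj k (triv k H) M) (X₂ := M)
    (m₁ := (tensorObj k (triv k H) M).isModule)
    { lid k M with
      map_smul' := lid_action k M }

/-- The map `Extⁿ(k, k) → Extⁿ(M, M)` given by the exact functor `- ⊗ₖ M` and `k ⊗ₖ M ≅ M`. -/
noncomputable def psi (M : ModuleCat.{u} H) (n : ℕ) (ζ : Ext (triv k H) (triv k H) n) : Ext M M n :=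
  (Ext.mk₀ (lidIso k M).inv).comp
    ((ζ.mapExactFunctor (tensorFunctor k M)).comp (Ext.mk₀ (lidIso k M).hom) (add_zero n)) (zero_add n)


theorem psi_one (M : ModuleCat.{u} H) :
    psi k M 0 (Ext.mk₀ (𝟙 (triv k H))) = Ext.mk₀ (𝟙 M) := by
  rw [psi, Ext.mapExactFunctor_mk₀, Ext.mk₀_comp_mk₀, Ext.mk₀_comp_mk₀]
  simp

theorem psi_comp (M : ModuleCat.{u} H) {a b c : ℕ} (ζ : Ext (triv k H) (triv k H) a)
    (ξ : Ext (triv k H) (triv k H) b) (h : a + b = c) :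
    psi k M c (ζ.comp ξ h) = (psi k M a ζ).comp (psi k M b ξ) h := by
  subst h
  simp only [psi, Ext.mapExactFunctor_comp]
  rw [Ext.comp_assoc (Ext.mk₀ (lidIso k M).inv) _ _ (zero_add a) rfl (by omega)]
  congr 1
  rw [Ext.comp_assoc_of_second_deg_zero, ← Ext.comp_assoc (Ext.mk₀ (lidIso k M).hom)
    (Ext.mk₀ (lidIso k M).inv) _ (zero_add 0) (zero_add b) (by omega)]
  rw [Ext.mk₀_comp_mk₀, Iso.hom_inv_id, Ext.mk₀_id_comp, Ext.comp_assoc_of_third_deg_zero]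

theorem psi_zero (M : ModuleCat.{u} H) (n : ℕ) : psi k M n 0 = 0 := by
  simp [psi]

theorem psi_add (M : ModuleCat.{u} H) (n : ℕ) (ζ ξ : Ext (triv k H) (triv k H) n) :
    psi k M n (ζ + ξ) = psi k M n ζ + psi k M n ξ := by
  simp [psi]

/-- The graded algebra `Ext*_H(k, k)`. -/
abbrev ExtAlg (k H : Type u) [Field k] [Ring H] [Bialgebra k H] : Type u :=
  ⨁ n : ℕ, Ext (triv k H) (triv k H) n

/-- The graded group `Ext*_H(M, N)`. -/
def ExtMod (M N : ModuleCat.{u} H) : Type u := ⨁ n : ℕ, Ext M N n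

noncomputable instance (M N : ModuleCat.{u} H) : AddCommGroup (ExtMod M N) :=
  inferInstanceAs (AddCommGroup (⨁ n : ℕ, Ext M N n))

/-- The graded action of `Ext*(k, k)` on `Ext*(M, N)`: `ζ • α` is `psi ζ` followed by `α`. With the
Yoneda products in diagrammatic order this is a left action; with products written in
the order of composition of maps it is the right action `α ∘ psi ζ`. -/
@[reducible] noncomputable def gmodule (M N : ModuleCat.{u} H) :
    DirectSum.Gmodule (fun n : ℕ => Ext (triv k H) (triv k H) n) (fun n : ℕ => Ext M N n) where
  smul {a _} ζ α := (psi k M a ζ).comp α rfl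
  one_smul := by
    rintro ⟨n, α⟩
    refine (ExtRingOf.mk_comp (psi k M 0 (Ext.mk₀ (𝟙 (triv k H)))) α _ (zero_add n)).trans ?_
    rw [psi_one, Ext.mk₀_id_comp]
    rfl
  mul_smul := by
    rintro ⟨a, ζ⟩ ⟨b, ξ⟩ ⟨c, α⟩
    refine (ExtRingOf.mk_comp (psi k M (a + b) (ζ.comp ξ rfl)) α _ rfl).trans
      (Eq.trans ?_ (ExtRingOf.mk_comp (psi k M a ζ) ((psi k M b ξ).comp α rfl)
        (add_assoc a b c).symm rfl))
    rw [psi_comp, Ext.comp_assoc _ _ α rfl rfl rfl]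
  smul_add _ _ _ := Ext.comp_add ..
  smul_zero _ := Ext.comp_zero ..
  add_smul ζ ξ α := by
    change (psi k M _ (ζ + ξ)).comp α rfl = _
    rw [psi_add]
    exact Ext.add_comp ..
  zero_smul α := by
    change (psi k M _ 0).comp α rfl = _
    rw [psi_zero]
    exact Ext.zero_comp ..

/-- `Ext*(M, N)` as a module over `Ext*(k, k)`. -/
noncomputable instance (M N : ModuleCat.{u} H) : Module (ExtAlg k H) (ExtMod M N) :=
  letI := gmodule k M N
  inferInstanceAs (Module (⨁ n : ℕ, Ext (triv k H) (triv k H) n) (⨁ n : ℕ, Ext M N n))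

theorem of_smul_of (M N : ModuleCat.{u} H) {a b : ℕ} (ζ : Ext (triv k H) (triv k H) a) (α : Ext M N b) :
    ((DirectSum.of (fun n : ℕ => Ext (triv k H) (triv k H) n) a ζ : ExtAlg k H) •
     (show ExtMod M N from DirectSum.of (fun n : ℕ => Ext M N n) b α)) =
     DirectSum.of (fun n : ℕ => Ext M N n) (a + b) ((psi k M a ζ).comp α rfl) := by
  let := gmodule k M N
  exact DirectSum.Gmodule.of_smul_of (fun n : ℕ => Ext (triv k H) (triv k H) n) _ ζ α

end BialgMod
end ExtPart

end ExtFG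

/-! Write S for `repS` (the sum of the two characters of g), Eⱼ for `repE j` and B for `repB`. The
sequences 0 → S → Eⱼ → S → 0 define xⱼ in Ext¹(S,S), and 0 → E₀ → B → E₀ → 0 defines z in
Ext¹(E₀,E₀).

Tensoring with M keeps these sequences exact and makes B ⊗ M projective (`projective_tensor_B`).
Hence z maps Extⁿ(E₀⊗M,N) onto Extⁿ⁺¹(E₀⊗M,N), and Ext*(E₀⊗M,N) is a k[z]-module generated by the
finite-dimensional space Hom(E₀⊗M,N), so it is Noetherian. The map Ext*(S⊗M,N) → Ext*(E₀⊗M,N)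
induced by E₀ → S has kernel x₀·Ext* in positive degrees and intertwines x₁ with z (`headE_comp_x`).
Its image is a k[z]-submodule, so in high degrees Extⁿ⁺¹(S⊗M,N) = x₀Extⁿ + x₁Extⁿ
(`exists_degree_generated`).

It remains to pass from S to its summand k. Each xⱼ exchanges the two characters, so only xⱼ²
restricts to k, giving ηⱼ in Ext²(k,k) (`eta`). Because x₀ and x₁ commute (`x_comm`), every cubic
monomial in them contains a square, so the squares alone generate high degrees. With k ⊗ M ≅ M, each
Extⁿ(M,N) is finite-dimensional, and Extⁿ⁺²(M,N) = η₀Extⁿ + η₁Extⁿ for large n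
(`ext_finite_and_psi_generated`). Both finiteness statements follow by induction on the degree.
Characteristic different from two enters only through the averaging in `exists_equivariant_section`.
-/

namespace ExtFG

/-! ### Linear algebra of graded spaces with degree-one operators -/

section Growth
variable {k : Type*} [Field k] {T U L : ℕ → Type*}
  [∀ n, AddCommGroup (T n)] [∀ n, Module k (T n)]
  [∀ n, AddCommGroup (U n)] [∀ n, Module k (U n)]
  [∀ n, AddCommGroup (L n)] [∀ n, Module k (L n)]

theorem finite_of_degreewise_surjective (Z : ∀ n, U n →ₗ[k] U (n + 1))
    (hZ : ∀ n, Function.Surjective (Z n)) (h0 : Module.Finite k (U 0)) (n : ℕ) :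
    Module.Finite k (U n) := by
  induction n with
  | zero => exact h0
  | succ n ih => exact Module.Finite.of_surjective (Z n) (hZ n)

/-- `T (n + 1)` is an extension of a subspace of `U (n + 1)` by a subspace of the image of `T n`, so
finiteness climbs degree by degree. -/
theorem finite_of_kernel_le_range (X : ∀ n, T n →ₗ[k] T (n + 1)) (P : ∀ n, T n →ₗ[k] U n)
    (h0 : Function.Injective (P 0))
    (hX : ∀ n (t : T (n + 1)), P (n + 1) t = 0 → ∃ s, X n s = t)
    (hU : ∀ n, Module.Finite k (U n)) (n : ℕ) : Module.Finite k (T n) := by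
  induction n with
  | zero => exact Module.Finite.of_injective (P 0) h0
  | succ n ih =>
    have h1 : (LinearMap.ker (P (n + 1))).FG := by
      have hle : LinearMap.ker (P (n + 1)) ≤ LinearMap.range (X n) := fun t ht => hX n t ht
      exact Submodule.FG.of_le (Module.Finite.iff_fg.1 (Module.Finite.range (X n))) hle
    rw [Module.finite_def]
    refine Submodule.fg_of_fg_map_of_fg_inf_ker (P (n + 1)) ?_ (by simpa using h1)
    exact IsNoetherian.noetherian _

/-- A family of subspaces of the quotients `U n` of a finite-dimensional space which is stable
under the transition maps is eventually carried onto itself. -/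
theorem exists_stable_degree (Z : ∀ n, U n →ₗ[k] U (n + 1))
    (hZ : ∀ n, Function.Surjective (Z n)) (h0 : Module.Finite k (U 0))
    (I : ∀ n, Submodule k (U n)) (hI : ∀ n, ∀ x ∈ I n, Z n x ∈ I (n + 1)) :
    ∃ n₀, ∀ n ≥ n₀, ∀ x ∈ I (n + 1), ∃ y ∈ I n, Z n y = x := by
  let z : ∀ n, U 0 →ₗ[k] U n := fun n =>
    Nat.rec (motive := fun n => U 0 →ₗ[k] U n) LinearMap.id (fun n f => (Z n).comp f) n
  have zs : ∀ n x, z (n + 1) x = Z n (z n x) := fun _ _ => rfl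
  have hz : ∀ n, Function.Surjective (z n) := by
    intro n
    induction n with
    | zero => exact fun x => ⟨x, rfl⟩
    | succ n ih => exact (hZ n).comp ih
  -- All the `I n` are compared inside the single finite-dimensional space `U 0`, where their
  -- preimages form an ascending chain.
  let J : ℕ →o Submodule k (U 0) :=
    ⟨fun n => (I n).comap (z n), monotone_nat_of_le_succ fun n x hx => hI n _ hx⟩
  obtain ⟨n₀, hn₀⟩ := monotone_stabilizes_iff_noetherian.2
    (inferInstance : IsNoetherian k (U 0)) J
  refine ⟨n₀, fun n hn x hx => ?_⟩
  obtain ⟨v, rfl⟩ := hz (n + 1) x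
  have hv : v ∈ J (n + 1) := hx
  rw [← hn₀ (n + 1) (by omega), hn₀ n hn] at hv
  exact ⟨z n v, hv, rfl⟩

/-- The images of the `P n` are stable under `Z`, hence eventually carried onto each other by it. A
class is then corrected by some `X₂ n b` until it dies under `P`, and what is left lies in the image
of `X₁`. -/
theorem exists_degree_generated (X₁ X₂ : ∀ n, T n →ₗ[k] T (n + 1))
    (Z : ∀ n, U n →ₗ[k] U (n + 1)) (P : ∀ n, T n →ₗ[k] U n)
    (hX : ∀ n (t : T (n + 1)), P (n + 1) t = 0 → ∃ s, X₁ n s = t)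
    (hZ : ∀ n, Function.Surjective (Z n)) (hP : ∀ n t, P (n + 1) (X₂ n t) = Z n (P n t))
    (hU : Module.Finite k (U 0)) :
    ∃ n₀, ∀ n ≥ n₀, ∀ t : T (n + 1), ∃ a b, t = X₁ n a + X₂ n b := by
  obtain ⟨n₀, h⟩ := exists_stable_degree Z hZ hU (fun n => LinearMap.range (P n)) (by
    rintro n _ ⟨t, rfl⟩
    exact ⟨X₂ n t, hP n t⟩)
  refine ⟨n₀, fun n hn t => ?_⟩
  obtain ⟨_, ⟨b, rfl⟩, hb⟩ := h n hn _ ⟨t, rfl⟩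
  obtain ⟨a, ha⟩ := hX n (t - X₂ n b) (by rw [map_sub, hP, hb, sub_self])
  exact ⟨a, b, by rw [ha, sub_add_cancel]⟩

/-- A monomial of degree three in two commuting variables is divisible by the square of one of them.
-/
theorem exists_degree_generated_sq (X₁ X₂ : ∀ n, T n →ₗ[k] T (n + 1))
    (hX : ∀ n t, X₁ (n + 1) (X₂ n t) = X₂ (n + 1) (X₁ n t))
    (h : ∃ n₀, ∀ n ≥ n₀, ∀ t : T (n + 1), ∃ a b, t = X₁ n a + X₂ n b) :
    ∃ n₀, ∀ n ≥ n₀, ∀ t : T (n + 2), ∃ a b,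
      t = X₁ (n + 1) (X₁ n a) + X₂ (n + 1) (X₂ n b) := by
  obtain ⟨n₀, h⟩ := h
  -- Degree two would leave the mixed monomial, so a third decomposition is needed, which starts one
  -- degree lower.
  refine ⟨n₀ + 1, fun n hn t => ?_⟩
  obtain ⟨m, rfl⟩ : ∃ m, n = m + 1 := ⟨n - 1, by omega⟩
  obtain ⟨a, b, rfl⟩ := h (m + 2) (by omega) t
  obtain ⟨a₁, a₂, rfl⟩ := h (m + 1) (by omega) a
  obtain ⟨b₁, b₂, rfl⟩ := h (m + 1) (by omega) b
  obtain ⟨c₁, c₂, rfl⟩ := h m (by omega) a₂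
  obtain ⟨d₁, d₂, rfl⟩ := h m (by omega) b₁
  -- Coefficients of X₁² and X₂² after the mixed terms X₁X₂a₂ and X₂X₁b₁ are expanded once more and
  -- reordered.
  refine ⟨a₁ + X₂ m c₁ + X₂ m d₁, b₂ + X₁ m c₂ + X₁ m d₂, ?_⟩
  simp only [map_add, hX]
  abel

/-- The idempotents `p ∘ i` commute with the squares of the operators, so a decomposition in `T` can
be compressed to the retract `L`. -/
theorem exists_degree_generated_retract (X₁ X₂ : ∀ n, T n →ₗ[k] T (n + 1))
    (i : ∀ n, T n →ₗ[k] L n) (p : ∀ n, L n →ₗ[k] T n) (hip : ∀ n l, i n (p n l) = l)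
    (h₁ : ∀ n t, p (n + 2) (i (n + 2) (X₁ (n + 1) (X₁ n t))) =
      X₁ (n + 1) (X₁ n (p n (i n t))))
    (h₂ : ∀ n t, p (n + 2) (i (n + 2) (X₂ (n + 1) (X₂ n t))) =
      X₂ (n + 1) (X₂ n (p n (i n t))))
    (h : ∃ n₀, ∀ n ≥ n₀, ∀ t : T (n + 2), ∃ a b,
      t = X₁ (n + 1) (X₁ n a) + X₂ (n + 1) (X₂ n b)) :
    ∃ n₀, ∀ n ≥ n₀, ∀ l : L (n + 2), ∃ a b,
      l = i (n + 2) (X₁ (n + 1) (X₁ n (p n a))) + i (n + 2) (X₂ (n + 1) (X₂ n (p n b))) := by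
  obtain ⟨n₀, h⟩ := h
  refine ⟨n₀, fun n hn l => ?_⟩
  obtain ⟨a, b, hab⟩ := h n hn (p (n + 2) l)
  refine ⟨i n a, i n b, ?_⟩
  rw [← h₁, ← h₂, hip, hip, ← map_add, ← hab, hip]

end Growth

/-! ### Growth of Ext in an abelian category, and its transfer along an exact functor -/

section ExtGrowth
open CategoryTheory Abelian
universe v w
variable (k : Type u) [Field k] {C : Type v} [Category.{w} C] [Abelian C] [Linear k C]
  [HasExt.{u} C]

/-- Precomposition by an extension class, as a linear map. -/
noncomputable def extPrecomp {X Y : C} {a : ℕ} (x : Ext X Y a) (N : C) {n m : ℕ} (h : a + n = m) :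
    Ext Y N n →ₗ[k] Ext X N m where
  toFun t := x.comp t h
  map_add' _ _ := Ext.comp_add ..
  map_smul' r t := Ext.comp_smul x t h r

@[simp] theorem extPrecomp_apply {X Y : C} {a : ℕ} (x : Ext X Y a) (N : C) {n m : ℕ}
    (h : a + n = m) (t : Ext Y N n) : extPrecomp k x N h t = x.comp t h := rfl

/-- The degree two endo-extension of a retract `K` of `S` obtained from `x ∈ Ext¹(S, S)`. -/
noncomputable def sqClass {K S : C} (ι : K ⟶ S) (q : S ⟶ K) (x : Ext S S 1) : Ext K K 2 :=
  (Ext.mk₀ ι).comp ((x.comp (x.comp (Ext.mk₀ q) (add_zero 1)) rfl : Ext S K 2)) (zero_add 2)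

theorem sqClass_comp {K S N : C} (ι : K ⟶ S) (q : S ⟶ K) (x : Ext S S 1) {n : ℕ}
    (t : Ext K N n) :
    (sqClass ι q x).comp t (add_comm 2 n) = (Ext.mk₀ ι).comp (x.comp (x.comp
      ((Ext.mk₀ q).comp t (zero_add n)) (add_comm 1 n)) (add_comm 1 (n + 1))) (zero_add (n + 2)) := by
  have e₁ := Ext.comp_assoc x (Ext.mk₀ q) t (add_zero 1) (zero_add n)
    (by omega : 1 + 0 + n = n + 1)
  have e₂ := Ext.comp_assoc x (x.comp (Ext.mk₀ q) (add_zero 1)) t (rfl : 1 + 1 = 2)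
    (add_comm 1 n) (by omega : 1 + 1 + n = n + 2)
  have e₃ := Ext.comp_assoc (Ext.mk₀ ι) (x.comp (x.comp (Ext.mk₀ q) (add_zero 1))
    (rfl : 1 + 1 = 2)) t (zero_add 2) (add_comm 2 n) (by omega : 0 + 2 + n = n + 2)
  rw [e₁] at e₂
  rw [e₂] at e₃
  exact e₃

theorem comp_comp_swap {K S T N : C} {x : Ext K S 1} {y : Ext S T 1} {x' : Ext K S 1}
    {y' : Ext S T 1} (h : x.comp y rfl = x'.comp y' (rfl : 1 + 1 = 2)) {n : ℕ}
    (t : Ext T N n) :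
    x.comp (y.comp t (add_comm 1 n)) (add_comm 1 (n + 1)) =
      x'.comp (y'.comp t (add_comm 1 n)) (add_comm 1 (n + 1)) := by
  rw [← Ext.comp_assoc x y t (rfl : 1 + 1 = 2) (add_comm 1 n) (by omega : 1 + 1 + n = n + 1 + 1),
    ← Ext.comp_assoc x' y' t (rfl : 1 + 1 = 2) (add_comm 1 n) (by omega : 1 + 1 + n = n + 1 + 1), h]

/-- The abstract core, with P in the role of B. The long exact sequences of the two extensions
supply the hypotheses of the growth lemmas: one identifies the kernel of Ext(S,N) → Ext(E,N), the
other gives surjectivity on Ext(E,N). The hypotheses `h₁` and `h₂` let the squares descend to the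
summand K. -/
theorem ext_finite_and_generated {K S E P : C} (ι : K ⟶ S) (q : S ⟶ K) (hιq : ι ≫ q = 𝟙 K)
    {f : S ⟶ E} {g : E ⟶ S} {hfg : f ≫ g = 0} (hE : (ShortComplex.mk f g hfg).ShortExact)
    {f' : E ⟶ P} {g' : P ⟶ E} {hfg' : f' ≫ g' = 0} (hP : (ShortComplex.mk f' g' hfg').ShortExact)
    (y : Ext S S 1)
    (hcomm : Ext.comp hE.extClass y rfl = y.comp hE.extClass (rfl : 1 + 1 = 2))
    (hy : (Ext.mk₀ g).comp y (zero_add 1) = Ext.comp hP.extClass (Ext.mk₀ g) (add_zero 1))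
    (h₁ : ((Ext.mk₀ (q ≫ ι)).comp (Ext.comp hE.extClass hE.extClass rfl) (zero_add 2) : Ext S S 2) =
      (Ext.comp hE.extClass hE.extClass rfl : Ext S S 2).comp (Ext.mk₀ (q ≫ ι)) (add_zero 2))
    (h₂ : ((Ext.mk₀ (q ≫ ι)).comp (y.comp y rfl) (zero_add 2) : Ext S S 2) =
      (y.comp y rfl : Ext S S 2).comp (Ext.mk₀ (q ≫ ι)) (add_zero 2))
    (N : C) (hN : ∀ n (t : Ext P N (n + 1)), t = 0) (hfin : Module.Finite k (E ⟶ N)) :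
    (∀ n, Module.Finite k (Ext K N n)) ∧ ∃ n₀, ∀ n ≥ n₀, ∀ t : Ext K N (n + 2),
      ∃ a b : Ext K N n, t = (sqClass ι q hE.extClass).comp a (add_comm 2 n) +
        (sqClass ι q y).comp b (add_comm 2 n) := by
  have hfin0 : Module.Finite k (Ext E N 0) :=
    Module.Finite.equiv (Ext.linearEquiv₀ (R := k) (X := E) (Y := N)).symm
  -- The obstruction to lifting along the connecting map lies in Extⁿ⁺¹(P,N), which vanishes.
  have hZ : ∀ n, Function.Surjective (extPrecomp k hP.extClass N (add_comm 1 n)) := by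
    intro n t
    exact Ext.contravariant_sequence_exact₃ hP N t (hN n _) (add_comm 1 n)
  have hX : ∀ n (t : Ext S N (n + 1)), extPrecomp k (Ext.mk₀ g) N (zero_add (n + 1)) t = 0 →
      ∃ s, extPrecomp k hE.extClass N (add_comm 1 n) s = t := fun n t ht =>
    Ext.contravariant_sequence_exact₃ hE N t ht (add_comm 1 n)
  have hinj : Function.Injective (extPrecomp k (Ext.mk₀ g) N (zero_add 0)) := by
    have := hE.epi_g
    rw [← LinearMap.ker_eq_bot, LinearMap.ker_eq_bot']
    intro t ht
    obtain ⟨r, rfl⟩ := Ext.addEquiv₀.symm.surjective t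
    simpa [← cancel_epi g] using ht
  have hU := finite_of_degreewise_surjective (U := fun n => Ext E N n) _ hZ hfin0
  have hT := finite_of_kernel_le_range (T := fun n => Ext S N n) (U := fun n => Ext E N n)
    (fun n => extPrecomp k hE.extClass N (add_comm 1 n))
    (fun n => extPrecomp k (Ext.mk₀ g) N (zero_add n)) hinj hX hU
  have hip : ∀ n (l : Ext K N n), (Ext.mk₀ ι).comp ((Ext.mk₀ q).comp l (zero_add n)) (zero_add n) =
      l := fun n l => by
    rw [← Ext.comp_assoc_of_second_deg_zero, Ext.mk₀_comp_mk₀, hιq, Ext.mk₀_id_comp]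
  have hsq : ∀ z : Ext S S 1, ((Ext.mk₀ (q ≫ ι)).comp (z.comp z rfl) (zero_add 2) : Ext S S 2) =
      (z.comp z rfl : Ext S S 2).comp (Ext.mk₀ (q ≫ ι)) (add_zero 2) → ∀ n (t : Ext S N n),
      (Ext.mk₀ q).comp ((Ext.mk₀ ι).comp (z.comp (z.comp t (add_comm 1 n)) (add_comm 1 (n + 1)))
        (zero_add (n + 2))) (zero_add (n + 2)) =
      z.comp (z.comp ((Ext.mk₀ q).comp ((Ext.mk₀ ι).comp t (zero_add n)) (zero_add n))
        (add_comm 1 n)) (add_comm 1 (n + 1)) := by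
    intro z hz n t
    rw [Ext.mk₀_comp_mk₀_assoc, Ext.mk₀_comp_mk₀_assoc,
      ← Ext.comp_assoc z z t (rfl : 1 + 1 = 2) (add_comm 1 n) (by omega : 1 + 1 + n = n + 1 + 1),
      ← Ext.comp_assoc z z _ (rfl : 1 + 1 = 2) (add_comm 1 n) (by omega : 1 + 1 + n = n + 1 + 1),
      ← Ext.comp_assoc _ _ t (zero_add 2) (add_comm 2 n) (by omega), hz,
      Ext.comp_assoc _ _ t (add_zero 2) (zero_add n) (by omega)]
  refine ⟨fun n => ?_, ?_⟩
  · exact Module.Finite.of_surjective (extPrecomp k (Ext.mk₀ ι) N (zero_add n))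
      fun l => ⟨_, hip n l⟩
  · have hg : ∀ n (t : Ext S N n), extPrecomp k (Ext.mk₀ g) N (zero_add (n + 1))
        (extPrecomp k y N (add_comm 1 n) t) =
        extPrecomp k hP.extClass N (add_comm 1 n)
          (extPrecomp k (Ext.mk₀ g) N (zero_add n) t) := fun n t => by
      simp only [extPrecomp_apply]
      rw [← Ext.comp_assoc _ y t (zero_add 1) (add_comm 1 n) (by omega : 0 + 1 + n = n + 1), hy,
        Ext.comp_assoc_of_second_deg_zero]
    have h₁' := exists_degree_generated (T := fun n => Ext S N n) (U := fun n => Ext E N n)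
      (fun n => extPrecomp k hE.extClass N (add_comm 1 n))
      (fun n => extPrecomp k y N (add_comm 1 n))
      (fun n => extPrecomp k hP.extClass N (add_comm 1 n))
      (fun n => extPrecomp k (Ext.mk₀ g) N (zero_add n)) hX hZ hg hfin0
    have h₂' := exists_degree_generated_sq (T := fun n => Ext S N n)
      (fun n => extPrecomp k hE.extClass N (add_comm 1 n))
      (fun n => extPrecomp k y N (add_comm 1 n)) (fun n t => comp_comp_swap hcomm t) h₁'
    have h := exists_degree_generated_retract (T := fun n => Ext S N n) (L := fun n => Ext K N n)
      (fun n => extPrecomp k hE.extClass N (add_comm 1 n))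
      (fun n => extPrecomp k y N (add_comm 1 n))
      (fun n => extPrecomp k (Ext.mk₀ ι) N (zero_add n))
      (fun n => extPrecomp k (Ext.mk₀ q) N (zero_add n)) hip (hsq _ h₁) (hsq _ h₂) h₂'
    simpa only [sqClass_comp, extPrecomp_apply] using h

/-- An exact functor preserves extension classes, their products and hence all relations among them.
The relations are therefore verified once, before applying F; only the vanishing of Ext from F(P)
and the finiteness of Hom concern the image. -/
theorem ext_map_finite_and_generated {C : Type v} [Category.{w} C] [Abelian C] [HasExt.{u} C]
    {D : Type v} [Category.{w} D] [Abelian D] [Linear k D] [HasExt.{u} D] (F : C ⥤ D) [F.Additive]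
    [Limits.PreservesFiniteLimits F] [Limits.PreservesFiniteColimits F]
    {K S E P : C} (ι : K ⟶ S) (q : S ⟶ K) (hιq : ι ≫ q = 𝟙 K)
    {f : S ⟶ E} {g : E ⟶ S} {hfg : f ≫ g = 0} (hE : (ShortComplex.mk f g hfg).ShortExact)
    {f' : E ⟶ P} {g' : P ⟶ E} {hfg' : f' ≫ g' = 0} (hP : (ShortComplex.mk f' g' hfg').ShortExact)
    (y : Ext S S 1)
    (hcomm : Ext.comp hE.extClass y rfl = y.comp hE.extClass (rfl : 1 + 1 = 2))
    (hy : (Ext.mk₀ g).comp y (zero_add 1) = Ext.comp hP.extClass (Ext.mk₀ g) (add_zero 1))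
    (h₁ : ((Ext.mk₀ (q ≫ ι)).comp (Ext.comp hE.extClass hE.extClass rfl) (zero_add 2) : Ext S S 2) =
      (Ext.comp hE.extClass hE.extClass rfl : Ext S S 2).comp (Ext.mk₀ (q ≫ ι)) (add_zero 2))
    (h₂ : ((Ext.mk₀ (q ≫ ι)).comp (y.comp y rfl) (zero_add 2) : Ext S S 2) =
      (y.comp y rfl : Ext S S 2).comp (Ext.mk₀ (q ≫ ι)) (add_zero 2))
    (N : D) (hN : ∀ n (t : Ext (F.obj P) N (n + 1)), t = 0)
    (hfin : Module.Finite k (F.obj E ⟶ N)) :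
    (∀ n, Module.Finite k (Ext (F.obj K) N n)) ∧ ∃ n₀, ∀ n ≥ n₀, ∀ t : Ext (F.obj K) N (n + 2),
      ∃ a b : Ext (F.obj K) N n,
        t = ((sqClass ι q hE.extClass).mapExactFunctor F).comp a (add_comm 2 n) +
          ((sqClass ι q y).mapExactFunctor F).comp b (add_comm 2 n) := by
  have hE' : (ShortComplex.mk (F.map f) (F.map g) (by rw [← F.map_comp, hfg, F.map_zero])).ShortExact :=
    hE.map_of_exact F
  have hP' : (ShortComplex.mk (F.map f') (F.map g')
    (by rw [← F.map_comp, hfg', F.map_zero])).ShortExact := hP.map_of_exact F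
  have eE : hE.extClass.mapExactFunctor F = hE'.extClass := Ext.mapExactFunctor_extClass F hE
  have eP : hP.extClass.mapExactFunctor F = hP'.extClass := Ext.mapExactFunctor_extClass F hP
  have key := ext_finite_and_generated k (F.map ι) (F.map q) (by rw [← F.map_comp, hιq, F.map_id])
    hE' hP' (y.mapExactFunctor F)
    (by rw [← eE]
        exact (Ext.mapExactFunctor_comp F hE.extClass y rfl).symm.trans
          ((congrArg (Ext.mapExactFunctor F) hcomm).trans
            (Ext.mapExactFunctor_comp F y hE.extClass rfl)))
    (by
      have h := congrArg (Ext.mapExactFunctor F) hy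
      rw [Ext.mapExactFunctor_comp, Ext.mapExactFunctor_comp, Ext.mapExactFunctor_mk₀] at h
      rw [← eP]
      exact h)
    (by
      have h := congrArg (Ext.mapExactFunctor F) h₁
      simp only [Ext.mapExactFunctor_comp, Ext.mapExactFunctor_mk₀, F.map_comp] at h
      rw [← eE]
      exact h)
    (by
      have h := congrArg (Ext.mapExactFunctor F) h₂
      simp only [Ext.mapExactFunctor_comp, Ext.mapExactFunctor_mk₀, F.map_comp] at h
      exact h) N hN hfin
  have hs : ∀ x : Ext S S 1, (sqClass ι q x).mapExactFunctor F =
      sqClass (F.map ι) (F.map q) (x.mapExactFunctor F) := fun x => by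
    simp only [sqClass, Ext.mapExactFunctor_comp, Ext.mapExactFunctor_mk₀]
  rw [hs, hs]
  rw [← eE] at key
  exact key

end ExtGrowth
end ExtFG

namespace ExtFG
open CategoryTheory Abelian

/-! ### Modules over A given by generators -/

namespace AlgA
variable {k : Type u} [Field k]

/-- The elements satisfying `p` form a subalgebra containing the generators. By the universal
property A maps to this subalgebra, and composing with the inclusion gives the identity. -/
theorem induction {p : AlgA k → Prop} (hc : ∀ c, p (algebraMap k (AlgA k) c))
    (hy : ∀ i, p (y k i)) (hg : p (g k)) (hadd : ∀ a b, p a → p b → p (a + b))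
    (hmul : ∀ a b, p a → p b → p (a * b)) (a : AlgA k) : p a := by
  let S : Subalgebra k (AlgA k) :=
    { carrier := {a | p a}
      mul_mem' := fun {a b} => hmul a b
      add_mem' := fun {a b} => hadd a b
      algebraMap_mem' := hc }
  let F : AlgA k →ₐ[k] S := lift (fun i => ⟨y k i, hy i⟩) ⟨g k, hg⟩
    (fun i => Subtype.ext (y_sq k i)) (Subtype.ext (y_anticomm k)) (Subtype.ext (g_sq k))
    (fun i => Subtype.ext (g_mul_y k i))
  have h : S.val.comp F = AlgHom.id k _ := algHom_ext (fun i => by simp [F]) (by simp [F])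
  have := DFunLike.congr_fun h a
  rw [← show ((F a : S) : AlgA k) = a from this]
  exact (F a).2

/-- An additive map compatible with the scalars, the `yᵢ` and `g` is `A`-linear. -/
def linearMapOfGenerators {X Y : Type*} [AddCommGroup X] [AddCommGroup Y] [Module (AlgA k) X]
    [Module (AlgA k) Y] (f : X →+ Y)
    (hc : ∀ (c : k) x, f (algebraMap k (AlgA k) c • x) = algebraMap k (AlgA k) c • f x)
    (hy : ∀ i x, f (y k i • x) = y k i • f x) (hg : ∀ x, f (g k • x) = g k • f x) :
    X →ₗ[AlgA k] Y where
  toFun := f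
  map_add' := f.map_add
  map_smul' a := by
    induction a using AlgA.induction with
    | hc c => exact hc c
    | hy i => exact hy i
    | hg => exact hg
    | hadd a b ha hb =>
      intro x
      simp only [RingHom.id_apply] at ha hb ⊢
      rw [add_smul, map_add, ha, hb, add_smul]
    | hmul a b ha hb =>
      intro x
      simp only [RingHom.id_apply] at ha hb ⊢
      rw [mul_smul, ha, hb, mul_smul]

end AlgA

/-- A representation of the generators of `A` on a `k`-vector space. -/
structure GenRep (k : Type u) [Field k] (V : Type u) [AddCommGroup V] [Module k V] where
  /-- The operator of `yᵢ`. -/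
  y : Fin 2 → Module.End k V
  /-- The operator of `g`. -/
  g : Module.End k V
  sq : ∀ i, y i * y i = 0
  anticomm : y 0 * y 1 + y 1 * y 0 = 0
  g_sq : g * g = 1
  g_mul_y : ∀ i, g * y i = -(y i * g)

namespace GenRep
variable {k : Type u} [Field k] {V W X : Type u} [AddCommGroup V] [Module k V] [AddCommGroup W]
  [Module k W] [AddCommGroup X] [Module k X]

/-- The algebra map of a representation. -/
noncomputable def alg (ρ : GenRep k V) : AlgA k →ₐ[k] Module.End k V :=
  AlgA.lift ρ.y ρ.g ρ.sq ρ.anticomm ρ.g_sq ρ.g_mul_y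

/-- The `A`-module of a representation. -/
noncomputable def mod (ρ : GenRep k V) : ModuleCat.{u} (AlgA k) :=
  @ModuleCat.of (AlgA k) _ V _ (Module.compHom V ρ.alg.toRingHom)

/-- A vector of `V` as an element of the `A`-module. -/
def vec (ρ : GenRep k V) : V ≃+ ρ.mod := AddEquiv.refl V

theorem y_smul (ρ : GenRep k V) (i : Fin 2) (v : V) : AlgA.y k i • ρ.vec v = ρ.vec (ρ.y i v) :=
  LinearMap.congr_fun (AlgA.lift_y ρ.y ρ.g ρ.sq ρ.anticomm ρ.g_sq ρ.g_mul_y i) v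

theorem g_smul (ρ : GenRep k V) (v : V) : AlgA.g k • ρ.vec v = ρ.vec (ρ.g v) :=
  LinearMap.congr_fun (AlgA.lift_g ρ.y ρ.g ρ.sq ρ.anticomm ρ.g_sq ρ.g_mul_y) v

theorem algebraMap_smul (ρ : GenRep k V) (c : k) (v : V) :
    algebraMap k (AlgA k) c • ρ.vec v = ρ.vec (c • v) :=
  LinearMap.congr_fun (ρ.alg.commutes c) v

/-- The homomorphism given by an intertwining linear map. -/
noncomputable def hom (ρ : GenRep k V) (σ : GenRep k W) (f : V →ₗ[k] W)
    (hy : ∀ i v, f (ρ.y i v) = σ.y i (f v)) (hg : ∀ v, f (ρ.g v) = σ.g (f v)) : ρ.mod ⟶ σ.mod :=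
  ModuleCat.ofHom (X := ρ.mod) (Y := σ.mod)
    (AlgA.linearMapOfGenerators ((σ.vec.toAddMonoidHom.comp f.toAddMonoidHom).comp
      ρ.vec.symm.toAddMonoidHom)
      (fun c x => by
        obtain ⟨v, rfl⟩ := ρ.vec.surjective x
        exact (congrArg (fun x => σ.vec (f (ρ.vec.symm x))) (ρ.algebraMap_smul c v)).trans
          ((congrArg σ.vec (f.map_smul c v)).trans (σ.algebraMap_smul c (f v)).symm))
      (fun i x => by
        obtain ⟨v, rfl⟩ := ρ.vec.surjective x
        exact (congrArg (fun x => σ.vec (f (ρ.vec.symm x))) (ρ.y_smul i v)).trans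
          ((congrArg σ.vec (hy i v)).trans (σ.y_smul i (f v)).symm))
      (fun x => by
        obtain ⟨v, rfl⟩ := ρ.vec.surjective x
        exact (congrArg (fun x => σ.vec (f (ρ.vec.symm x))) (ρ.g_smul v)).trans
          ((congrArg σ.vec (hg v)).trans (σ.g_smul (f v)).symm)))

theorem hom_ext {ρ : GenRep k V} {Y : ModuleCat.{u} (AlgA k)} {f g : ρ.mod ⟶ Y}
    (h : ∀ v, f.hom (ρ.vec v) = g.hom (ρ.vec v)) : f = g := by
  ext x
  exact h x

theorem shortExact {ρ : GenRep k V} {σ : GenRep k W} {π : GenRep k X} {f : V →ₗ[k] W}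
    {g : W →ₗ[k] X} {hfy hfg} {hgy hgg}
    (h0 : hom ρ σ f hfy hfg ≫ hom σ π g hgy hgg = 0) (hf : Function.Injective f)
    (hg : Function.Surjective g) (h : ∀ w, g w = 0 → ∃ v, f v = w) :
    (ShortComplex.mk _ _ h0).ShortExact := by
  refine ShortComplex.ShortExact.mk' ?_ ?_ ?_
  · rw [ShortComplex.ShortExact.moduleCat_exact_iff_function_exact]
    intro w
    constructor
    · exact fun hw => h w hw
    · rintro ⟨v, rfl⟩
      exact congrArg (fun φ => φ.hom v) h0
  · rw [ModuleCat.mono_iff_injective]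
    exact hf
  · rw [ModuleCat.epi_iff_surjective]
    exact hg

end GenRep
end ExtFG

namespace ExtFG
open CategoryTheory Abelian

/-! ### The explicit modules S, Eⱼ, C, B and the relations among their extension classes -/

namespace Koszul
open GenRep
variable (k : Type u) [Field k]

/-- The involution `(a, b) ↦ (a, -b)`. -/
def sgn : k × k →ₗ[k] k × k := LinearMap.prodMap LinearMap.id (-LinearMap.id)

/-- The exchange `(a, b) ↦ (b, a)`. -/
def swap : k × k →ₗ[k] k × k := (LinearEquiv.prodComm k k k).toLinearMap

theorem sgn_apply (v : k × k) : sgn k v = (v.1, -v.2) := rfl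
theorem swap_apply (v : k × k) : swap k v = (v.2, v.1) := rfl
@[simp] theorem sgn_sgn (v : k × k) : sgn k (sgn k v) = v := by simp [sgn_apply]
@[simp] theorem swap_swap (v : k × k) : swap k (swap k v) = v := rfl
@[simp] theorem swap_sgn (v : k × k) : swap k (sgn k v) = -sgn k (swap k v) := by
  simp [sgn_apply, swap_apply]
@[simp] theorem swap_inj (v w : k × k) : swap k v = swap k w ↔ v = w :=
  (LinearEquiv.prodComm k k k).injective.eq_iff

/-- The semisimple module `k ⊕ k_sgn`. -/
def repS : GenRep k (k × k) where
  y _ := 0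
  g := sgn k
  sq _ := by simp
  anticomm := by simp
  g_sq := LinearMap.ext fun v => sgn_sgn k v
  g_mul_y _ := by simp

/-- Two copies of `k ⊕ k_sgn`. -/
def repD : GenRep k ((k × k) × (k × k)) where
  y _ := 0
  g := LinearMap.prodMap (sgn k) (sgn k)
  sq _ := by simp
  anticomm := by simp
  g_sq := LinearMap.ext fun v => by simp
  g_mul_y _ := by simp

/-- The quotient of the regular module by the generator other than `yⱼ`. -/
def repE (j : Fin 2) : GenRep k ((k × k) × (k × k)) where
  y i := if i = j then LinearMap.inr k _ _ ∘ₗ LinearMap.fst k _ _ else 0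
  g := LinearMap.prodMap (sgn k) (-sgn k)
  sq i := by split_ifs <;> exact LinearMap.ext fun v => by simp
  anticomm := by fin_cases j <;> simp
  g_sq := LinearMap.ext fun v => by simp
  g_mul_y i := by split_ifs <;> exact LinearMap.ext fun v => by simp

/-- The quotient of the regular module by its socle. -/
def repC : GenRep k ((k × k) × (k × k) × (k × k)) where
  y i := if i = 0 then
      { toFun := fun v => (0, v.1, 0)
        map_add' := fun _ _ => by simp
        map_smul' := fun _ _ => by simp }
    else
      { toFun := fun v => (0, 0, v.1)
        map_add' := fun _ _ => by simp
        map_smul' := fun _ _ => by simp }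
  g := LinearMap.prodMap (sgn k) (LinearMap.prodMap (-sgn k) (-sgn k))
  sq i := by split_ifs <;> exact LinearMap.ext fun v => by simp
  anticomm := LinearMap.ext fun v => by simp
  g_sq := LinearMap.ext fun v => by simp
  g_mul_y i := by split_ifs <;> exact LinearMap.ext fun v => by simp

/-- The regular module, in coordinates with respect to `1, y₀, y₁, y₀y₁`. -/
def repB : GenRep k ((k × k) × (k × k) × (k × k) × (k × k)) where
  y i := if i = 0 then
      { toFun := fun v => (0, v.1, 0, v.2.2.1)
        map_add' := fun _ _ => by simp
        map_smul' := fun _ _ => by simp }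
    else
      -- The sign records y₁y₀ = -y₀y₁.
      { toFun := fun v => (0, 0, v.1, -v.2.1)
        map_add' := fun _ _ => by simp [add_comm]
        map_smul' := fun _ _ => by simp }
  g := LinearMap.prodMap (sgn k) (LinearMap.prodMap (-sgn k) (LinearMap.prodMap (-sgn k) (sgn k)))
  sq i := by split_ifs <;> exact LinearMap.ext fun v => by simp
  anticomm := LinearMap.ext fun v => by simp
  g_sq := LinearMap.ext fun v => by simp
  g_mul_y i := by split_ifs <;> exact LinearMap.ext fun v => by simp

section hom
variable {k}

/-- The inclusion of the socle of `repE j`. -/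
noncomputable def socE (j : Fin 2) : (repS k).mod ⟶ (repE k j).mod :=
  -- On the socle g acts by `-sgn`, since yⱼ anticommutes with g; `swap` conjugates this to `sgn`.
  hom _ _ (LinearMap.inr k _ _ ∘ₗ swap k) (fun i v => by simp [repS, repE]; split_ifs <;> simp)
    (fun v => by simp [repS, repE])

/-- The projection of `repE j` to its head. -/
noncomputable def headE (j : Fin 2) : (repE k j).mod ⟶ (repS k).mod :=
  hom _ _ (LinearMap.fst k _ _) (fun i v => by simp [repS, repE]; split_ifs <;> simp)
    (fun v => by simp [repS, repE])

theorem socE_headE (j : Fin 2) : socE (k := k) j ≫ headE j = 0 := hom_ext fun _ => rfl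

theorem shortExact_E (j : Fin 2) : (ShortComplex.mk _ _ (socE_headE (k := k) j)).ShortExact :=
  shortExact (socE_headE j) (fun v w h => by
      simp only [LinearMap.comp_apply, LinearMap.inr_apply, Prod.mk.injEq, swap_inj,
        true_and] at h
      exact h)
    (fun v => ⟨(v, 0), rfl⟩) (fun w h => ⟨swap k w.2, Prod.ext h.symm (by simp)⟩)

/-- The inclusion of `repE 0` in the regular module, with image generated by `y₁`. -/
noncomputable def inclE : (repE k 0).mod ⟶ (repB k).mod :=
  hom _ _ { toFun := fun v => (0, 0, swap k v.1, swap k v.2)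
            map_add' := fun _ _ => by simp
            map_smul' := fun _ _ => by simp }
    (fun i v => by fin_cases i <;> simp [repB, repE]) (fun v => by simp [repB, repE])

/-- The projection of the regular module to `repE 0`. -/
noncomputable def projE : (repB k).mod ⟶ (repE k 0).mod :=
  hom _ _ { toFun := fun v => (v.1, v.2.1)
            map_add' := fun _ _ => by simp
            map_smul' := fun _ _ => by simp }
    (fun i v => by fin_cases i <;> simp [repB, repE]) (fun v => by simp [repB, repE])

theorem inclE_projE : inclE (k := k) ≫ projE = 0 := hom_ext fun _ => rfl

theorem shortExact_B : (ShortComplex.mk _ _ (inclE_projE (k := k))).ShortExact :=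
  shortExact inclE_projE (fun v w h => by
      simp only [LinearMap.coe_mk, AddHom.coe_mk, Prod.mk.injEq, swap_inj, true_and] at h
      exact Prod.ext h.1 h.2)
    (fun v => ⟨(v.1, v.2, 0, 0), rfl⟩)
    (fun w h => ⟨(swap k w.2.2.1, swap k w.2.2.2), by
      simp only [LinearMap.coe_mk, AddHom.coe_mk, Prod.mk_eq_zero] at h
      simp [Prod.ext_iff] at h ⊢
      simp [h]⟩)

/-- The inclusion of the socle of the regular module. -/
noncomputable def socB : (repS k).mod ⟶ (repB k).mod :=
  hom _ _ { toFun := fun v => (0, 0, 0, v)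
            map_add' := fun _ _ => by simp
            map_smul' := fun _ _ => by simp }
    (fun i v => by fin_cases i <;> simp [repB, repS]) (fun v => by simp [repB, repS])

/-- The projection of the regular module to its quotient by the socle. -/
noncomputable def projC : (repB k).mod ⟶ (repC k).mod :=
  hom _ _ { toFun := fun v => (v.1, v.2.1, v.2.2.1)
            map_add' := fun _ _ => by simp
            map_smul' := fun _ _ => by simp }
    (fun i v => by fin_cases i <;> simp [repB, repC]) (fun v => by simp [repB, repC])

theorem socB_projC : socB (k := k) ≫ projC = 0 := hom_ext fun _ => rfl

theorem shortExact_socB : (ShortComplex.mk _ _ (socB_projC (k := k))).ShortExact :=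
  shortExact socB_projC (fun v w h => by simpa [Prod.ext_iff] using h)
    (fun v => ⟨(v.1, v.2.1, v.2.2, 0), rfl⟩)
    (fun w h => ⟨w.2.2.2, by
      simp [Prod.ext_iff] at h ⊢
      simp [h]⟩)

/-- The inclusion of the socle of `repC`. -/
noncomputable def socC : (repD k).mod ⟶ (repC k).mod :=
  hom _ _ { toFun := fun v => (0, swap k v.1, swap k v.2)
            map_add' := fun _ _ => by simp
            map_smul' := fun _ _ => by simp }
    (fun i v => by fin_cases i <;> simp [repD, repC]) (fun v => by simp [repD, repC])

/-- The projection of `repC` to its head. -/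
noncomputable def headC : (repC k).mod ⟶ (repS k).mod :=
  hom _ _ (LinearMap.fst k _ _)
    (fun i v => by fin_cases i <;> simp [repS, repC]) (fun v => by simp [repS, repC])

theorem socC_headC : socC (k := k) ≫ headC = 0 := hom_ext fun _ => rfl

theorem shortExact_C : (ShortComplex.mk _ _ (socC_headC (k := k))).ShortExact :=
  shortExact socC_headC (fun v w h => by
      simp only [LinearMap.coe_mk, AddHom.coe_mk, Prod.mk.injEq, swap_inj, true_and] at h
      exact Prod.ext h.1 h.2)
    (fun v => ⟨(v, 0, 0), rfl⟩)
    (fun w h => ⟨(swap k w.2.1, swap k w.2.2), by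
      simp [Prod.ext_iff] at h ⊢
      simp [h]⟩)

/-- The inclusion of the first summand of `repD`. -/
noncomputable def inlD : (repS k).mod ⟶ (repD k).mod :=
  hom _ _ (LinearMap.inl k _ _) (fun i v => by simp [repS, repD]) (fun v => by simp [repS, repD])

/-- The inclusion of the second summand of `repD`. -/
noncomputable def inrD : (repS k).mod ⟶ (repD k).mod :=
  hom _ _ (LinearMap.inr k _ _) (fun i v => by simp [repS, repD]) (fun v => by simp [repS, repD])

/-- The projection of `repD` to the first summand. -/
noncomputable def fstD : (repD k).mod ⟶ (repS k).mod :=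
  hom _ _ (LinearMap.fst k _ _) (fun i v => by simp [repS, repD]) (fun v => by simp [repS, repD])

/-- The projection of `repD` to the second summand. -/
noncomputable def sndD : (repD k).mod ⟶ (repS k).mod :=
  hom _ _ (LinearMap.snd k _ _) (fun i v => by simp [repS, repD]) (fun v => by simp [repS, repD])

theorem fstD_inlD_add : fstD (k := k) ≫ inlD + sndD ≫ inrD = 𝟙 _ :=
  hom_ext fun v => congrArg (repD k).vec (Prod.fst_add_snd v)

/-- The class of `0 → S → Eⱼ → S → 0`. -/
noncomputable def x (k : Type u) [Field k] (j : Fin 2) : Ext (repS k).mod (repS k).mod 1 :=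
  (shortExact_E (k := k) j).extClass

/-- The class of `0 → E₀ → B → E₀ → 0`. -/
noncomputable def clsB (k : Type u) [Field k] : Ext (repE k 0).mod (repE k 0).mod 1 :=
  (shortExact_B (k := k)).extClass

/-- The class of `0 → S → B → C → 0`. -/
noncomputable def clsSoc (k : Type u) [Field k] : Ext (repC k).mod (repS k).mod 1 :=
  (shortExact_socB (k := k)).extClass

/-- The class of `0 → S ⊕ S → C → S → 0`. -/
noncomputable def clsC (k : Type u) [Field k] : Ext (repS k).mod (repD k).mod 1 :=
  (shortExact_C (k := k)).extClass

/-- The idempotent endomorphisms of `k ⊕ k_sgn`. -/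
noncomputable def idem (s : Fin 2) : (repS k).mod ⟶ (repS k).mod :=
  hom _ _ (if s = 0 then LinearMap.inl k k k ∘ₗ LinearMap.fst k k k
      else LinearMap.inr k k k ∘ₗ LinearMap.snd k k k)
    (fun i v => by simp [repS]) (fun v => by split_ifs <;> simp [repS, sgn_apply])

/-- Multiplication by yⱼ reverses the sign of g, so the part of Eⱼ over one character of the head
has the other character as its socle. The class xⱼ therefore exchanges the two idempotents, and its
square commutes with them. -/
theorem idem_comp_x (s j : Fin 2) : (Ext.mk₀ (idem (k := k) s)).comp (x k j) (zero_add 1) =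
    (x k j).comp (Ext.mk₀ (idem (1 - s))) (add_zero 1) := by
  let φ : ShortComplex.mk _ _ (socE_headE (k := k) j) ⟶ ShortComplex.mk _ _ (socE_headE (k := k) j) :=
    { τ₁ := idem (1 - s)
      τ₂ := hom _ _ (if s = 0 then
            LinearMap.prodMap (LinearMap.inl k k k ∘ₗ LinearMap.fst k k k)
              (LinearMap.inl k k k ∘ₗ LinearMap.fst k k k)
          else
            LinearMap.prodMap (LinearMap.inr k k k ∘ₗ LinearMap.snd k k k)
              (LinearMap.inr k k k ∘ₗ LinearMap.snd k k k))
        (fun i v => by fin_cases s <;> simp [repE] <;> split_ifs <;> simp)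
        (fun v => by fin_cases s <;> simp [repE, sgn_apply])
      τ₃ := idem s
      comm₁₂ := hom_ext fun v => by fin_cases s <;> rfl
      comm₂₃ := hom_ext fun v => by fin_cases s <;> rfl }
  exact (ShortComplex.ShortExact.extClass_naturality (shortExact_E (k := k) j) (shortExact_E (k := k) j) φ).symm

theorem idem_comp_sq (j : Fin 2) : ((Ext.mk₀ (idem (k := k) 0)).comp ((x k j).comp (x k j) rfl)
      (zero_add 2) : Ext _ _ 2) =
    ((x k j).comp (x k j) rfl : Ext _ _ 2).comp (Ext.mk₀ (idem 0)) (add_zero 2) := by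
  rw [← Ext.comp_assoc _ _ _ (zero_add 1) (rfl : 1 + 1 = 2)
      (by omega : 0 + 1 + 1 = 2), idem_comp_x,
    Ext.comp_assoc _ _ _ (add_zero 1) (zero_add 1) (by omega : 1 + 0 + 1 = 2), idem_comp_x,
    ← Ext.comp_assoc_of_third_deg_zero]
  rfl

/-- Killing y₀ maps B onto E₁ and induces the head map of E₀ at both ends of the sequence 0 → E₀ → B
→ E₀ → 0. This is why z on Ext(E₀,N) restricts x₁. -/
theorem headE_comp_x : (Ext.mk₀ (headE (k := k) 0)).comp (x k 1) (zero_add 1) =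
    (clsB k).comp (Ext.mk₀ (headE 0)) (add_zero 1) := by
  let φ : ShortComplex.mk _ _ (inclE_projE (k := k)) ⟶ ShortComplex.mk _ _ (socE_headE (k := k) 1) :=
    { τ₁ := headE 0
      τ₂ := hom _ _ { toFun := fun v => (v.1, v.2.2.1)
                      map_add' := fun _ _ => by simp
                      map_smul' := fun _ _ => by simp }
        (fun i v => by fin_cases i <;> simp [repE, repB]) (fun v => by simp [repE, repB])
      τ₃ := headE 0
      comm₁₂ := hom_ext fun v => rfl
      comm₂₃ := hom_ext (ρ := repB k) fun v => show (repS k).vec v.1 = (repS k).vec v.1 from rfl }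
  exact (ShortComplex.ShortExact.extClass_naturality
    (shortExact_B (k := k)) (shortExact_E (k := k) 1) φ).symm

/-- Pushing C out along one summand of its socle kills the other generator and leaves E₀; the second
summand similarly gives E₁. -/
theorem extClass_C_comp_fstD :
    (clsC k).comp (Ext.mk₀ fstD) (add_zero 1) = x k 0 := by
  let φ : ShortComplex.mk _ _ (socC_headC (k := k)) ⟶ ShortComplex.mk _ _ (socE_headE (k := k) 0) :=
    { τ₁ := fstD
      τ₂ := hom _ _ { toFun := fun v => (v.1, v.2.1)
                      map_add' := fun _ _ => by simp
                      map_smul' := fun _ _ => by simp }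
        (fun i v => by fin_cases i <;> simp [repE, repC]) (fun v => by simp [repE, repC])
      τ₃ := 𝟙 _
      comm₁₂ := hom_ext fun v => rfl
      comm₂₃ := hom_ext fun v => rfl }
  exact (ShortComplex.ShortExact.extClass_naturality
    (shortExact_C (k := k)) (shortExact_E (k := k) 0) φ).trans
    (Ext.mk₀_id_comp _)

theorem extClass_C_comp_sndD :
    (clsC k).comp (Ext.mk₀ sndD) (add_zero 1) = x k 1 := by
  let φ : ShortComplex.mk _ _ (socC_headC (k := k)) ⟶ ShortComplex.mk _ _ (socE_headE (k := k) 1) :=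
    { τ₁ := sndD
      τ₂ := hom _ _ { toFun := fun v => (v.1, v.2.2)
                      map_add' := fun _ _ => by simp
                      map_smul' := fun _ _ => by simp }
        (fun i v => by fin_cases i <;> simp [repE, repC]) (fun v => by simp [repE, repC])
      τ₃ := 𝟙 _
      comm₁₂ := hom_ext fun v => rfl
      comm₂₃ := hom_ext fun v => rfl }
  exact (ShortComplex.ShortExact.extClass_naturality
    (shortExact_C (k := k)) (shortExact_E (k := k) 1) φ).trans
    (Ext.mk₀_id_comp _)

theorem inrD_comp_extClass_socB : (Ext.mk₀ (inrD (k := k) ≫ socC)).comp (clsSoc k)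
    (zero_add 1) = x k 0 := by
  let φ : ShortComplex.mk _ _ (socE_headE (k := k) 0) ⟶ ShortComplex.mk _ _ socB_projC :=
    { τ₁ := 𝟙 _
      τ₂ := inclE
      τ₃ := inrD ≫ socC
      comm₁₂ := hom_ext fun v => rfl
      comm₂₃ := hom_ext fun v => rfl }
  exact (ShortComplex.ShortExact.extClass_naturality (shortExact_E (k := k) 0) shortExact_socB φ).symm.trans
    (Ext.comp_mk₀_id _)

/-- The submodule of B generated by y₀ is a copy of E₁. Its socle map to the socle of B carries the
sign of y₁y₀ = -y₀y₁, whereas the copy of E₀ generated by y₁ carries none. -/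
theorem inlD_comp_extClass_socB : (Ext.mk₀ (inlD (k := k) ≫ socC)).comp (clsSoc k)
    (zero_add 1) = -x k 1 := by
  let φ : ShortComplex.mk _ _ (socE_headE (k := k) 1) ⟶ ShortComplex.mk _ _ socB_projC :=
    { τ₁ := -𝟙 _
      τ₂ := hom _ _ { toFun := fun v => (0, swap k v.1, 0, -swap k v.2)
                      map_add' := fun _ _ => by simp [add_comm]
                      map_smul' := fun _ _ => by simp }
        (fun i v => by fin_cases i <;> simp [repE, repB]) (fun v => by simp [repE, repB])
      τ₃ := inlD ≫ socC
      comm₁₂ := hom_ext fun v => rfl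
      comm₂₃ := hom_ext fun v => rfl }
  refine (ShortComplex.ShortExact.extClass_naturality (shortExact_E (k := k) 1)
    shortExact_socB φ).symm.trans ?_
  simp [φ, x, Ext.mk₀_neg]

/-- The class of C dies when pushed into C itself. Splitting the socle S ⊕ S of C and multiplying by
the class of 0 → S → B → C → 0 turns this vanishing into -x₀x₁ + x₁x₀ = 0. -/
theorem x_comm : ((x k 0).comp (x k 1) rfl : Ext _ _ 2) = (x k 1).comp (x k 0) rfl := by
  -- The identity is inserted so that it can be replaced by the sum of the two projections onto the
  -- socle.
  have h : (((clsC k).comp (Ext.mk₀ (𝟙 _ ≫ socC)) (add_zero 1)).comp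
      (clsSoc k) rfl : Ext _ _ 2) = 0 := by
    rw [Category.id_comp, clsC, ShortComplex.ShortExact.extClass_comp, Ext.zero_comp]
  rw [← fstD_inlD_add, Preadditive.add_comp, Ext.mk₀_add, Ext.comp_add, Ext.add_comp,
    Category.assoc, Category.assoc, ← Ext.mk₀_comp_mk₀ (fstD (k := k)), ← Ext.mk₀_comp_mk₀ (sndD (k := k)),
    ← Ext.comp_assoc_of_third_deg_zero, ← Ext.comp_assoc_of_third_deg_zero,
    extClass_C_comp_fstD, extClass_C_comp_sndD, Ext.comp_assoc_of_second_deg_zero,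
    Ext.comp_assoc_of_second_deg_zero, inrD_comp_extClass_socB, inlD_comp_extClass_socB,
    Ext.comp_neg, neg_add_eq_zero] at h
  exact h

end hom
end Koszul
end ExtFG

namespace ExtFG
open CategoryTheory Abelian
open scoped TensorProduct ModuleCat

/-! ### Skew derivations on additive maps, and sections commuting with g -/

namespace AlgA
variable (k : Type u) [Field k]

theorem y_mul_y_comm (i j : Fin 2) : y k i * y k j + y k j * y k i = 0 := by
  fin_cases i <;> fin_cases j
  · simp [y_sq]
  · exact y_anticomm k
  · rw [add_comm]; exact y_anticomm k
  · simp [y_sq]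

variable {k}

theorem g_smul_g_smul {M : Type*} [AddCommGroup M] [Module (AlgA k) M] (m : M) :
    g k • g k • m = m := by rw [smul_smul, g_sq, one_smul]

theorem y_smul_y_smul {M : Type*} [AddCommGroup M] [Module (AlgA k) M] (i : Fin 2) (m : M) :
    y k i • y k i • m = 0 := by rw [smul_smul, y_sq, zero_smul]

theorem g_smul_y_smul {M : Type*} [AddCommGroup M] [Module (AlgA k) M] (i : Fin 2) (m : M) :
    g k • y k i • m = -(y k i • g k • m) := by
  rw [smul_smul, g_mul_y, neg_smul, mul_smul]

theorem y_smul_y_smul_comm {M : Type*} [AddCommGroup M] [Module (AlgA k) M] (i j : Fin 2) (m : M) :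
    y k i • y k j • m = -(y k j • y k i • m) := by
  rw [smul_smul, smul_smul, eq_neg_iff_add_eq_zero, ← add_smul, y_mul_y_comm, zero_smul]

/-- The skew derivation `φ ↦ (m ↦ yᵢ φ(g m) - φ(yᵢ g m))` of additive maps between `A`-modules. -/
noncomputable def skewDer (k : Type u) [Field k] {M N : Type*} [AddCommGroup M] [Module (AlgA k) M] [AddCommGroup N]
    [Module (AlgA k) N] (i : Fin 2) : (M →+ N) →+ (M →+ N) where
  toFun φ :=
    { toFun := fun m => y k i • φ (g k • m) - φ (y k i • g k • m)
      map_zero' := by simp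
      map_add' := fun a b => by simp only [smul_add, map_add]; abel }
  map_zero' := by ext; simp
  map_add' φ χ := by
    ext m
    simp only [AddMonoidHom.coe_mk, ZeroHom.coe_mk, AddMonoidHom.add_apply, smul_add]
    abel

section skewDer
variable {M N : Type*} [AddCommGroup M] [Module (AlgA k) M] [AddCommGroup N] [Module (AlgA k) N]

theorem skewDer_apply (i : Fin 2) (φ : M →+ N) (m : M) :
    skewDer k i φ m = y k i • φ (g k • m) - φ (y k i • g k • m) := rfl

/-- This is the formula for Δ(yᵢ): a map from X ⊗ M respects yᵢ as soon as yᵢ on X corresponds to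
`skewDer` on additive maps from M. -/
theorem apply_y_smul_add (i : Fin 2) (φ : M →+ N) (m : M) :
    φ (y k i • m) + skewDer k i φ (g k • m) = y k i • φ m := by
  rw [skewDer_apply, g_smul_g_smul]
  abel

theorem skewDer_skewDer (i : Fin 2) (φ : M →+ N) : skewDer k i (skewDer k i φ) = 0 := by
  ext m
  simp only [skewDer_apply, g_smul_g_smul, g_smul_y_smul, smul_sub, y_smul_y_smul, smul_neg,
    map_neg, map_zero, neg_zero, AddMonoidHom.zero_apply]
  abel

/-- Together with `skewDer_skewDer`, this says that the skew derivations satisfy the defining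
relations of B, so they can serve as the images of y₀ and y₁. -/
theorem skewDer_comm (i j : Fin 2) (φ : M →+ N) :
    skewDer k i (skewDer k j φ) = -skewDer k j (skewDer k i φ) := by
  ext m
  simp only [skewDer_apply, g_smul_g_smul, g_smul_y_smul, smul_sub, smul_neg,
    map_neg, AddMonoidHom.neg_apply, y_smul_y_smul_comm i j]
  abel

theorem skewDer_comp_g {φ χ : M →+ N} (h : ∀ m, χ (g k • m) = g k • φ m) (i : Fin 2) (m : M) :
    skewDer k i χ (g k • m) = -(g k • skewDer k i φ m) := by
  have h' : ∀ m, χ m = g k • φ (g k • m) := fun m => by rw [← h, g_smul_g_smul]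
  simp only [skewDer_apply, h', g_smul_g_smul, g_smul_y_smul, smul_sub, smul_neg, map_neg]
  abel

theorem skewDer_balanced {φ χ : M →+ N} {c : AlgA k} (hc : ∀ a, c * a = a * c)
    (h : ∀ m, χ m = φ (c • m)) (i : Fin 2) (m : M) : skewDer k i χ m = skewDer k i φ (c • m) := by
  rw [skewDer_apply, skewDer_apply, h, h, smul_smul, smul_smul, smul_smul, smul_smul, smul_smul,
    hc (g k), mul_assoc c, hc (y k i * g k), mul_assoc]

theorem skewDer_smul {φ : M →+ N} {c : AlgA k} (hc : ∀ a, c * a = a * c)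
    (h : ∀ m, φ (c • m) = c • φ m) (i : Fin 2) (m : M) :
    skewDer k i φ (c • m) = c • skewDer k i φ m := by
  rw [← skewDer_balanced hc (φ := φ) (χ := (DistribSMul.toAddMonoidHom N c).comp φ)
    (fun m => (h m).symm)]
  simp only [skewDer_apply, AddMonoidHom.comp_apply, DistribSMul.toAddMonoidHom_apply, smul_sub,
    smul_smul, hc]

theorem map_skewDer {P : Type*} [AddCommGroup P] [Module (AlgA k) P] (f : N →ₗ[AlgA k] P)
    (i : Fin 2) (φ : M →+ N) : f.toAddMonoidHom.comp (skewDer k i φ) =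
      skewDer k i (f.toAddMonoidHom.comp φ) := by
  ext m
  simp [skewDer_apply]

/-- In characteristic not two, a surjection of `A`-modules has a section which commutes
with `g`. -/
theorem exists_equivariant_section (hk : ringChar k ≠ 2) {X Y : ModuleCat.{u} (AlgA k)}
    (π : X →ₗ[AlgA k] Y) (hπ : Function.Surjective π) :
    ∃ ψ : Y →ₗ[k] X, (∀ y, π (ψ y) = y) ∧ ∀ y, ψ (g k • y) = g k • ψ y := by
  obtain ⟨s, hs⟩ := (π.restrictScalars k).exists_rightInverse_of_surjective
    (LinearMap.range_eq_top.2 hπ)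
  have hs' : ∀ y, π (s y) = y := fun y => LinearMap.congr_fun hs y
  have h2 : (2 : k) ≠ 0 := Ring.two_ne_zero hk
  -- The average of a k-linear section s and its conjugate g s g.
  refine ⟨(2 : k)⁻¹ • (s + Algebra.lsmul k k X (g k) ∘ₗ s ∘ₗ Algebra.lsmul k k Y (g k)),
    fun y => ?_, fun y => ?_⟩
  · have : π ((2 : k)⁻¹ • (s y + g k • s (g k • y))) = (2 : k)⁻¹ • (y + y) := by
      rw [← LinearMap.restrictScalars_apply k, map_smul]
      simp only [LinearMap.restrictScalars_apply, map_add, map_smul, hs', g_smul_g_smul]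
    refine this.trans ?_
    rw [← two_smul k, smul_smul, inv_mul_cancel₀ h2, one_smul]
  · change (2 : k)⁻¹ • (s (g k • y) + g k • s (g k • g k • y)) =
      g k • (2 : k)⁻¹ • (s y + g k • s (g k • y))
    rw [smul_comm (g k) (2 : k)⁻¹, g_smul_g_smul, smul_add (g k), g_smul_g_smul, add_comm]

end skewDer
end AlgA

/-! ### Maps out of the tensor product of two modules -/

namespace BialgMod
variable {k : Type u} [Field k] (X M : ModuleCat.{u} (AlgA k))

/-- A pure tensor as an element of the `A`-module `X ⊗ M`. -/
noncomputable def tmul : X →+ M →+ (tensorFunctor k M).obj X :=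
  AddMonoidHom.mk' (fun x => AddMonoidHom.mk' (fun m => (x ⊗ₜ[k] m : X ⊗[k] M))
    (TensorProduct.tmul_add x)) (fun a b => by ext m; exact TensorProduct.add_tmul a b m)

variable {X M}

theorem y_smul_tmul (i : Fin 2) (x : X) (m : M) : AlgA.y k i • tmul X M x m =
    tmul X M x (AlgA.y k i • m) + tmul X M (AlgA.y k i • x) (AlgA.g k • m) := by
  change action k X M (AlgA.y k i) (x ⊗ₜ m) = _
  have : Bialgebra.comulAlgHom k (AlgA k) (AlgA.y k i) =
    1 ⊗ₜ AlgA.y k i + AlgA.y k i ⊗ₜ AlgA.g k := by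
    change AlgA.comulHom k _ = _
    rw [AlgA.comulHom, AlgA.lift_y]
  rw [action, AlgHom.comp_apply, AlgHom.comp_apply, this]
  simp only [map_add, Algebra.TensorProduct.map_tmul, Module.endTensorEndAlgHom_apply,
    LinearMap.add_apply, TensorProduct.AlgebraTensorModule.map_tmul, map_one]
  rfl

theorem g_smul_tmul (x : X) (m : M) : AlgA.g k • tmul X M x m =
    tmul X M (AlgA.g k • x) (AlgA.g k • m) := by
  change action k X M (AlgA.g k) (x ⊗ₜ m) = _
  have : Bialgebra.comulAlgHom k (AlgA k) (AlgA.g k) = AlgA.g k ⊗ₜ AlgA.g k := by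
    change AlgA.comulHom k _ = _
    rw [AlgA.comulHom, AlgA.lift_g]
  rw [action, AlgHom.comp_apply, AlgHom.comp_apply, this]
  simp only [Algebra.TensorProduct.map_tmul, Module.endTensorEndAlgHom_apply,
    TensorProduct.AlgebraTensorModule.map_tmul]
  rfl

theorem algebraMap_smul_tensor (c : k) (t : X ⊗[k] M) :
    (algebraMap k (AlgA k) c • (show (tensorFunctor k M).obj X from t)) = c • t :=
  LinearMap.congr_fun ((action k X M).commutes c) t

theorem tensor_addHom_ext {N : Type*} [AddCommGroup N] {f f' : (tensorFunctor k M).obj X →+ N}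
    (h : ∀ x m, f (tmul X M x m) = f' (tmul X M x m)) : f = f' := by
  ext t
  change X ⊗[k] M at t
  induction t using TensorProduct.induction_on with
  | zero => exact f.map_zero.trans f'.map_zero.symm
  | tmul x m => exact h x m
  | add s t hs ht =>
    exact (f.map_add s t).trans ((congrArg₂ (· + ·) hs ht).trans (f'.map_add s t).symm)

theorem tensor_hom_ext {N : ModuleCat.{u} (AlgA k)} {f f' : (tensorFunctor k M).obj X ⟶ N}
    (h : ∀ x m, f.hom (tmul X M x m) = f'.hom (tmul X M x m)) : f = f' := by
  ext t
  exact DFunLike.congr_fun (tensor_addHom_ext (f := f.hom.toAddMonoidHom)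
    (f' := f'.hom.toAddMonoidHom) h) t

/-- An additive map out of `X ⊗ M` from a balanced biadditive map. -/
noncomputable def tensorLiftAdd {N : Type*} [AddCommGroup N] (f : X →+ M →+ N)
    (hc : ∀ (c : k) x m, f (c • x) m = f x (c • m)) : (tensorFunctor k M).obj X →+ N :=
  AddMonoidHom.mk' (fun t : X ⊗[k] M => TensorProduct.liftAddHom f hc t)
    (TensorProduct.liftAddHom f hc).map_add

theorem tensorLiftAdd_tmul {N : Type*} [AddCommGroup N] (f : X →+ M →+ N)
    (hc : ∀ (c : k) x m, f (c • x) m = f x (c • m)) (x : X) (m : M) :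
    tensorLiftAdd f hc (tmul X M x m) = f x m := TensorProduct.liftAddHom_tmul f hc x m

theorem algebraMap_smul_tmul (c : k) (x : X) (m : M) : algebraMap k (AlgA k) c • tmul X M x m =
    tmul X M x (c • m) :=
  (algebraMap_smul_tensor c (x ⊗ₜ m)).trans (TensorProduct.tmul_smul c x m).symm

/-- An `A`-linear map out of `X ⊗ M` from a balanced biadditive map compatible with the
generators of `A`. -/
noncomputable def tensorLift {N : ModuleCat.{u} (AlgA k)} (f : X →+ M →+ N)
    (hc : ∀ (c : k) x m, f (c • x) m = f x (c • m)) (hc' : ∀ (c : k) x m, f x (c • m) = c • f x m)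
    (hy : ∀ i x m, f x (AlgA.y k i • m) + f (AlgA.y k i • x) (AlgA.g k • m) =
      AlgA.y k i • f x m)
    (hg : ∀ x m, f (AlgA.g k • x) (AlgA.g k • m) = AlgA.g k • f x m) :
    (tensorFunctor k M).obj X →ₗ[AlgA k] N :=
  AlgA.linearMapOfGenerators (X := (tensorFunctor k M).obj X) (tensorLiftAdd f hc)
    (fun c => DFunLike.congr_fun (tensor_addHom_ext
      (f := (tensorLiftAdd f hc).comp (DistribSMul.toAddMonoidHom _ (algebraMap k (AlgA k) c)))
      (f' := (DistribSMul.toAddMonoidHom N (algebraMap k (AlgA k) c)).comp (tensorLiftAdd f hc))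
      fun x m => by
        simp only [AddMonoidHom.comp_apply, DistribSMul.toAddMonoidHom_apply,
          algebraMap_smul_tmul, tensorLiftAdd_tmul, hc']
        rfl))
    (fun i => DFunLike.congr_fun (tensor_addHom_ext
      (f := (tensorLiftAdd f hc).comp (DistribSMul.toAddMonoidHom _ (AlgA.y k i)))
      (f' := (DistribSMul.toAddMonoidHom N (AlgA.y k i)).comp (tensorLiftAdd f hc))
      fun x m => by
        simp only [AddMonoidHom.comp_apply, DistribSMul.toAddMonoidHom_apply, map_add,
          y_smul_tmul, tensorLiftAdd_tmul, hy]))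
    (DFunLike.congr_fun (tensor_addHom_ext
      (f := (tensorLiftAdd f hc).comp (DistribSMul.toAddMonoidHom _ (AlgA.g k)))
      (f' := (DistribSMul.toAddMonoidHom N (AlgA.g k)).comp (tensorLiftAdd f hc))
      fun x m => by
        simp only [AddMonoidHom.comp_apply, DistribSMul.toAddMonoidHom_apply,
          g_smul_tmul, tensorLiftAdd_tmul, hg]))

theorem tensorLift_tmul {N : ModuleCat.{u} (AlgA k)} (f : X →+ M →+ N) {hc hc' hy hg} (x : X)
    (m : M) : tensorLift (N := N) f hc hc' hy hg (tmul X M x m) = f x m :=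
  tensorLiftAdd_tmul f hc x m

end BialgMod
end ExtFG

namespace ExtFG
open CategoryTheory Abelian
open scoped TensorProduct ModuleCat

/-! ### Projectivity of B ⊗ M -/

namespace Koszul
open GenRep BialgMod AlgA
variable {k : Type u} [Field k]

theorem repB_y_zero (v) : (repB k).y 0 v = (0, v.1, 0, v.2.2.1) := rfl
theorem repB_y_one (v) : (repB k).y 1 v = (0, 0, v.1, -v.2.1) := rfl
theorem repB_g (v) : (repB k).g v =
    (sgn k v.1, -sgn k v.2.1, -sgn k v.2.2.1, sgn k v.2.2.2) := rfl

section lift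
variable {M N : Type*} [AddCommGroup M] [Module (AlgA k) M] [AddCommGroup N] [Module (AlgA k) N]

/-- The biadditive map on `B × M` determined by its restriction to the degree zero part of `B`. -/
noncomputable def extendB (φ : k × k →+ M →+ N) : (repB k).mod →+ M →+ N :=
  (AddMonoidHom.mk' (fun v : (k × k) × (k × k) × (k × k) × (k × k) =>
    φ v.1 + skewDer k 0 (φ v.2.1) + skewDer k 1 (φ v.2.2.1) +
      skewDer k 0 (skewDer k 1 (φ v.2.2.2)))
    (fun v w => by simp only [Prod.fst_add, Prod.snd_add, map_add]; abel)).comp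
    (repB k).vec.symm.toAddMonoidHom

theorem extendB_vec (φ : k × k →+ M →+ N) (v : (k × k) × (k × k) × (k × k) × (k × k)) :
    extendB φ ((repB k).vec v) = φ v.1 + skewDer k 0 (φ v.2.1) + skewDer k 1 (φ v.2.2.1) +
      skewDer k 0 (skewDer k 1 (φ v.2.2.2)) := rfl

theorem extendB_y_smul (φ : k × k →+ M →+ N) (i : Fin 2) (x : (repB k).mod) :
    extendB φ (AlgA.y k i • x) = skewDer k i (extendB φ x) := by
  obtain ⟨v, rfl⟩ := (repB k).vec.surjective x
  rw [y_smul]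
  match i with
  | 0 => simp [extendB_vec, repB_y_zero, skewDer_skewDer]
  | 1 => simp [extendB_vec, repB_y_one, skewDer_skewDer, skewDer_comm (k := k) 1 0]

theorem extendB_g_smul (φ : k × k →+ M →+ N) (hφ : ∀ a m, φ (sgn k a) (AlgA.g k • m) = AlgA.g k • φ a m)
    (x : (repB k).mod) (m : M) :
    extendB φ (AlgA.g k • x) (AlgA.g k • m) = AlgA.g k • extendB φ x m := by
  obtain ⟨v, rfl⟩ := (repB k).vec.surjective x
  rw [g_smul]
  have h1 : ∀ i a m, skewDer k i (φ (sgn k a)) (AlgA.g k • m) = -(AlgA.g k • skewDer k i (φ a) m) :=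
    fun i a => skewDer_comp_g (hφ a) i
  have h2 : ∀ a m, skewDer k 0 (skewDer k 1 (φ (sgn k a))) (AlgA.g k • m) =
      AlgA.g k • skewDer k 0 (skewDer k 1 (φ a)) m := fun a m => by
    -- One skew derivation costs a sign under conjugation by g; it is absorbed in χ so that the
    -- lemma can be applied a second time.
    have := skewDer_comp_g (k := k) (φ := skewDer k 1 (φ a)) (χ := -skewDer k 1 (φ (sgn k a)))
      (fun m => by simp [h1]) 0 m
    simpa using this
  rw [extendB_vec, extendB_vec, repB_g]
  simp [h1, h2, hφ]

theorem extendB_balanced (φ : k × k →+ M →+ N)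
    (hφ : ∀ (c : k) a m, φ (c • a) m = φ a (algebraMap k (AlgA k) c • m))
    (c : k) (x : (repB k).mod) (m : M) :
    extendB φ (c • x) m = extendB φ x (algebraMap k (AlgA k) c • m) := by
  obtain ⟨v, rfl⟩ := (repB k).vec.surjective x
  have hc : ∀ a, algebraMap k (AlgA k) c * a = a * algebraMap k (AlgA k) c :=
    Algebra.commutes c
  have h1 : ∀ i a m, skewDer k i (φ (c • a)) m =
      skewDer k i (φ a) (algebraMap k (AlgA k) c • m) :=
    fun i a => skewDer_balanced hc (hφ c a) i
  have h2 : ∀ a m, skewDer k 0 (skewDer k 1 (φ (c • a))) m =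
      skewDer k 0 (skewDer k 1 (φ a)) (algebraMap k (AlgA k) c • m) :=
    fun a => skewDer_balanced hc (h1 1 a) 0
  refine (congrArg (fun x => extendB φ x m) ((repB k).algebraMap_smul c v)).trans ?_
  simp only [extendB_vec, Prod.smul_fst, Prod.smul_snd, AddMonoidHom.add_apply, hφ, h1, h2]

theorem extendB_smul (φ : k × k →+ M →+ N)
    (hφ : ∀ (c : k) a m, φ a (algebraMap k (AlgA k) c • m) = algebraMap k (AlgA k) c • φ a m)
    (c : k) (x : (repB k).mod) (m : M) :
    extendB φ x (algebraMap k (AlgA k) c • m) = algebraMap k (AlgA k) c • extendB φ x m := by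
  obtain ⟨v, rfl⟩ := (repB k).vec.surjective x
  have hc : ∀ a, algebraMap k (AlgA k) c * a = a * algebraMap k (AlgA k) c :=
    Algebra.commutes c
  have h1 : ∀ i a m, skewDer k i (φ a) (algebraMap k (AlgA k) c • m) =
      algebraMap k (AlgA k) c • skewDer k i (φ a) m :=
    fun i a => skewDer_smul hc (hφ c a) i
  have h2 : ∀ a m, skewDer k 0 (skewDer k 1 (φ a)) (algebraMap k (AlgA k) c • m) =
      algebraMap k (AlgA k) c • skewDer k 0 (skewDer k 1 (φ a)) m :=
    fun a => skewDer_smul hc (h1 1 a) 0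
  simp only [extendB_vec, AddMonoidHom.add_apply, hφ, h1, h2, smul_add]

/-- The degree zero part of `B`. -/
noncomputable def topB : k × k →+ (repB k).mod :=
  (repB k).vec.toAddMonoidHom.comp (AddMonoidHom.inl _ _)

/-- B is generated by its top under the words 1, y₀, y₁, y₀y₁, so a map turning y into `skewDer` is
recovered from its values on the top. -/
theorem extendB_comp_topB (θ : (repB k).mod →+ M →+ N)
    (hθ : ∀ i x, θ (AlgA.y k i • x) = skewDer k i (θ x)) : extendB (θ.comp topB) = θ := by
  ext x : 1
  obtain ⟨v, rfl⟩ := (repB k).vec.surjective x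
  have h : (repB k).vec v = topB v.1 + AlgA.y k 0 • topB v.2.1 + AlgA.y k 1 • topB v.2.2.1 +
      AlgA.y k 0 • AlgA.y k 1 • topB v.2.2.2 := by
    simp only [topB, AddMonoidHom.comp_apply, AddEquiv.toAddMonoidHom_eq_coe,
      AddMonoidHom.coe_coe, y_smul, ← map_add]
    congr 1
    simp [repB_y_zero, repB_y_one]
  rw [extendB_vec, h]
  simp only [map_add, hθ, AddMonoidHom.comp_apply]

theorem map_extendB {P : Type*} [AddCommGroup P] [Module (AlgA k) P] (f : N →ₗ[AlgA k] P)
    (φ : k × k →+ M →+ N) (x : (repB k).mod) : f.toAddMonoidHom.comp (extendB φ x) =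
      extendB ((AddMonoidHom.compHom f.toAddMonoidHom).comp φ) x := by
  obtain ⟨v, rfl⟩ := (repB k).vec.surjective x
  simp only [extendB_vec, AddMonoidHom.comp_add, map_skewDer]
  rfl

end lift

/-- An A-map from B ⊗ M amounts to a k-linear map on (top of B) ⊗ M commuting with g; the rest is
forced by the skew derivations. Such a map lifts along a surjection by composing with a
g-equivariant section, and the extension of the lift covers the original map because both are
determined on the top. -/
theorem projective_tensor_B (hk : ringChar k ≠ 2) (M : ModuleCat.{u} (AlgA k)) :
    Projective ((tensorFunctor k M).obj (repB k).mod) where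
  factors {N' N} h π _ := by
    obtain ⟨ψ, hψ, hψg⟩ := exists_equivariant_section hk π.hom
      ((ModuleCat.epi_iff_surjective π).1 inferInstance)
    let θ : (repB k).mod →+ M →+ N := (AddMonoidHom.compHom h.hom.toAddMonoidHom).comp
      (tmul (repB k).mod M)
    have hθ : ∀ x m, θ x m = h.hom (tmul _ M x m) := fun _ _ => rfl
    -- Solve the formula for yᵢ(x ⊗ gm) for the term yᵢx ⊗ m, using g² = 1.
    have hθy : ∀ i x, θ (AlgA.y k i • x) = skewDer k i (θ x) := fun i x => by
      ext m
      rw [skewDer_apply, hθ, hθ, hθ, ← map_smul, y_smul_tmul, map_add, add_sub_cancel_left,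
        AlgA.g_smul_g_smul]
    have hθc : ∀ (c : k) x m, θ (c • x) m = θ x (c • m) := fun c x m =>
      congrArg h.hom (TensorProduct.smul_tmul c x m)
    have hθc' : ∀ (c : k) x m, θ x (c • m) = c • θ x m := fun c x m => by
      rw [hθ, hθ, ← algebraMap_smul_tmul, map_smul]
      rfl
    have htop : ∀ a, topB (sgn k a) = AlgA.g k • topB a := fun a => by
      refine Eq.trans ?_ ((repB k).g_smul (a, 0)).symm
      rw [repB_g]
      simp [topB]
      rfl
    have htopc : ∀ (c : k) a, topB (c • a) = c • topB (k := k) a := fun c a => by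
      refine Eq.trans ?_ ((repB k).algebraMap_smul c (a, 0)).symm
      simp [topB]
    let φ : k × k →+ M →+ N' :=
      (AddMonoidHom.compHom ψ.toAddMonoidHom).comp (θ.comp topB)
    have hφ : ∀ a m, φ a m = ψ (θ (topB a) m) := fun _ _ => rfl
    have hπφ : (AddMonoidHom.compHom π.hom.toAddMonoidHom).comp φ = θ.comp topB := by
      ext a : 1
      ext m
      exact hψ _
    have hE : ∀ x m, π.hom (extendB φ x m) = θ x m := fun x m => by
      have := map_extendB π.hom φ x
      rw [hπφ, extendB_comp_topB θ hθy] at this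
      exact DFunLike.congr_fun this m
    let H := tensorLift (N := N') (extendB φ)
      (extendB_balanced φ fun c a m => by
        rw [hφ, hφ, htopc, hθc]
        rfl)
      (extendB_smul φ fun c a m => by
        rw [hφ, hφ]
        exact (congrArg ψ (hθc' c (topB a) m)).trans (ψ.map_smul c _))
      (fun i x m => by rw [extendB_y_smul, apply_y_smul_add])
      (extendB_g_smul φ fun a m => by
        rw [hφ, hφ, htop, ← hψg, hθ, hθ, ← g_smul_tmul]
        exact congrArg ψ (h.hom.map_smul _ _))
    refine ⟨ModuleCat.ofHom (X := (tensorFunctor k M).obj (repB k).mod) (Y := N') H,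
       tensor_hom_ext fun x m => ?_⟩
    have hH : H (tmul _ M x m) = extendB φ x m := tensorLift_tmul (extendB φ) x m
    exact (congrArg π.hom hH).trans (hE x m)

end Koszul
end ExtFG

namespace ExtFG
open CategoryTheory Abelian
open scoped TensorProduct ModuleCat DirectSum

/-! ### Finite dimensionality, and the right unit X ⊗ k -/

namespace AlgA
variable (k : Type u) [Field k]

/-- The relations allow every word to be reordered with y₀ first, then y₁, then g. So the product of
the three spans ⟨1,y₀⟩⟨1,y₁⟩⟨1,g⟩ is stable under left multiplication by the generators and,
containing 1, is all of A. -/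
theorem finite : Module.Finite k (AlgA k) := by
  let Y : Fin 2 → Submodule k (AlgA k) := fun i => Submodule.span k {1, y k i}
  let G : Submodule k (AlgA k) := Submodule.span k {1, g k}
  have one_Y : ∀ i, 1 ∈ Y i := fun i => Submodule.subset_span (by simp)
  have y_Y : ∀ i, y k i ∈ Y i := fun i => Submodule.subset_span (by simp)
  have one_G : 1 ∈ G := Submodule.subset_span (by simp)
  have g_G : g k ∈ G := Submodule.subset_span (by simp)
  have hYY : ∀ i, Y i * Y i ≤ Y i := fun i => by
    rw [Submodule.span_mul_span, Submodule.span_le]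
    rintro _ ⟨a, rfl | rfl, b, rfl | rfl, rfl⟩ <;> simp [one_Y, y_Y, y_sq]
  have hGG : G * G ≤ G := by
    rw [Submodule.span_mul_span, Submodule.span_le]
    rintro _ ⟨a, rfl | rfl, b, rfl | rfl, rfl⟩ <;> simp [one_G, g_G, g_sq]
  have hGY : ∀ i, G * Y i ≤ Y i * G := fun i => by
    rw [Submodule.span_mul_span, Submodule.span_le]
    rintro _ ⟨a, rfl | rfl, b, rfl | rfl, rfl⟩
    · exact Submodule.mul_mem_mul (one_Y i) one_G
    · simpa using Submodule.mul_mem_mul (y_Y i) one_G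
    · simpa using Submodule.mul_mem_mul (one_Y i) g_G
    · simpa [g_mul_y] using Submodule.mul_mem_mul (y_Y i) g_G
  have hY : Y 1 * Y 0 ≤ Y 0 * Y 1 := by
    rw [Submodule.span_mul_span, Submodule.span_le]
    rintro _ ⟨a, rfl | rfl, b, rfl | rfl, rfl⟩
    · exact Submodule.mul_mem_mul (one_Y 0) (one_Y 1)
    · simpa using Submodule.mul_mem_mul (y_Y 0) (one_Y 1)
    · simpa using Submodule.mul_mem_mul (one_Y 0) (y_Y 1)
    · simpa [eq_neg_of_add_eq_zero_left (y_mul_y_comm k 1 0)] using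
        Submodule.mul_mem_mul (y_Y 0) (y_Y 1)
  let S := Y 0 * Y 1 * G
  have h0 : Y 0 * S ≤ S := by
    rw [← mul_assoc, ← mul_assoc]
    exact mul_le_mul' (mul_le_mul' (hYY 0) le_rfl) le_rfl
  have h1 : Y 1 * S ≤ S :=
    calc Y 1 * S = Y 1 * Y 0 * (Y 1 * G) := by simp only [S, mul_assoc]
      _ ≤ Y 0 * Y 1 * (Y 1 * G) := mul_le_mul' hY le_rfl
      _ = Y 0 * (Y 1 * Y 1 * G) := by simp only [mul_assoc]
      _ ≤ Y 0 * (Y 1 * G) := mul_le_mul' le_rfl (mul_le_mul' (hYY 1) le_rfl)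
      _ = S := by simp only [S, mul_assoc]
  have hG : G * S ≤ S :=
    calc G * S = G * Y 0 * (Y 1 * G) := by simp only [S, mul_assoc]
      _ ≤ Y 0 * G * (Y 1 * G) := mul_le_mul' (hGY 0) le_rfl
      _ = Y 0 * (G * Y 1 * G) := by simp only [mul_assoc]
      _ ≤ Y 0 * (Y 1 * G * G) := mul_le_mul' le_rfl (mul_le_mul' (hGY 1) le_rfl)
      _ = Y 0 * Y 1 * (G * G) := by simp only [mul_assoc]
      _ ≤ S := mul_le_mul' le_rfl hGG
  have key : ∀ a : AlgA k, ∀ s ∈ S, a * s ∈ S := by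
    intro a
    induction a using AlgA.induction with
    | hc c => exact fun s hs => by rw [← Algebra.smul_def]; exact S.smul_mem c hs
    | hy i =>
      intro s hs
      match i with
      | 0 => exact h0 (Submodule.mul_mem_mul (y_Y 0) hs)
      | 1 => exact h1 (Submodule.mul_mem_mul (y_Y 1) hs)
    | hg => exact fun s hs => hG (Submodule.mul_mem_mul g_G hs)
    | hadd a b ha hb => exact fun s hs => by rw [add_mul]; exact S.add_mem (ha s hs) (hb s hs)
    | hmul a b ha hb => exact fun s hs => by rw [mul_assoc]; exact ha _ (hb s hs)
  have h1S : (1 : AlgA k) ∈ S := by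
    simpa using Submodule.mul_mem_mul (Submodule.mul_mem_mul (one_Y 0) (one_Y 1)) one_G
  have htop : S = ⊤ := eq_top_iff.2 fun a _ => by simpa using key a 1 h1S
  rw [Module.finite_def, ← htop]
  exact ((Submodule.fg_span (by simp)).mul (Submodule.fg_span (by simp))).mul
    (Submodule.fg_span (by simp))

variable {k}

theorem finite_restrict (M : ModuleCat.{u} (AlgA k)) (hM : Module.Finite (AlgA k) M) :
    Module.Finite k M :=
  have := AlgA.finite k
  Module.Finite.trans (AlgA k) M

theorem finite_hom (M N : ModuleCat.{u} (AlgA k)) (hM : Module.Finite k M)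
    (hN : Module.Finite k N) : Module.Finite k (M ⟶ N) :=
  Module.Finite.of_injective
    ({ toFun := fun f => f.hom.restrictScalars k
       map_add' := fun _ _ => rfl
       map_smul' := fun _ _ => rfl } : (M ⟶ N) →ₗ[k] (M →ₗ[k] N))
    fun f g h => by
      ext x
      exact LinearMap.congr_fun h x

end AlgA

namespace GenRep
variable {k : Type u} [Field k] {V : Type u} [AddCommGroup V] [Module k V]

theorem finite_mod (ρ : GenRep k V) [Module.Finite k V] : Module.Finite k ρ.mod :=
  Module.Finite.equiv ({ ρ.vec with
    map_smul' := fun c v => (ρ.algebraMap_smul c v).symm } : V ≃ₗ[k] ρ.mod)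

end GenRep

namespace BialgMod
variable {k : Type u} [Field k]

theorem finite_tensor (X M : ModuleCat.{u} (AlgA k)) (hX : Module.Finite k X)
    (hM : Module.Finite k M) : Module.Finite k ((tensorFunctor k M).obj X) :=
  Module.Finite.equiv ({ AddEquiv.refl (X ⊗[k] M) with
    map_smul' := fun c t => (algebraMap_smul_tensor c t).symm } :
      X ⊗[k] M ≃ₗ[k] (tensorFunctor k M).obj X)

theorem counit_y (i : Fin 2) : Coalgebra.counit (R := k) (AlgA.y k i) = 0 := by
  change AlgA.counitHom k _ = _
  rw [AlgA.counitHom, AlgA.lift_y]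

theorem counit_g : Coalgebra.counit (R := k) (AlgA.g k) = 1 := by
  change AlgA.counitHom k _ = _
  rw [AlgA.counitHom, AlgA.lift_g]

theorem y_smul_triv (i : Fin 2) (c : triv k (AlgA k)) : AlgA.y k i • c = 0 :=
  (trivEquiv k).injective (by rw [trivEquiv_smul, counit_y, zero_mul, map_zero])

theorem g_smul_triv (c : triv k (AlgA k)) : AlgA.g k • c = c :=
  (trivEquiv k).injective (by rw [trivEquiv_smul, counit_g, one_mul])

/-- The map `(x, c) ↦ c x`. -/
noncomputable def trivMul (X : ModuleCat.{u} (AlgA k)) : X →+ triv k (AlgA k) →+ X :=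
  AddMonoidHom.mk' (fun x => AddMonoidHom.mk' (fun c => trivEquiv k c • x)
    (fun a b => by rw [map_add, add_smul])) (fun a b => by ext; exact smul_add _ a b)

theorem trivMul_apply (X : ModuleCat.{u} (AlgA k)) (x : X) (c : triv k (AlgA k)) :
    trivMul X x c = trivEquiv k c • x := rfl

theorem trivMul_balanced (X : ModuleCat.{u} (AlgA k)) (c : k) (x : X) (m : triv k (AlgA k)) :
    trivMul X (c • x) m = trivMul X x (c • m) := by
  rw [trivMul_apply, trivMul_apply, map_smul, smul_assoc, smul_comm]

/-- The homomorphism `X ⊗ k → X`, `x ⊗ c ↦ c x`. -/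
noncomputable def rightUnit (X : ModuleCat.{u} (AlgA k)) :
    (tensorFunctor k (triv k (AlgA k))).obj X ⟶ X :=
  ModuleCat.ofHom (X := (tensorFunctor k (triv k (AlgA k))).obj X) (Y := X) <|
    tensorLift (trivMul X) (trivMul_balanced X)
      (fun c x m => by
        rw [trivMul_apply, trivMul_apply, map_smul, smul_assoc])
      (fun i x m => by
        simp only [trivMul_apply, y_smul_triv, g_smul_triv, map_zero, zero_add]
        rw [smul_comm])
      (fun x m => by
        simp only [trivMul_apply, g_smul_triv]
        rw [smul_comm])

theorem rightUnit_tmul (X : ModuleCat.{u} (AlgA k)) (x : X) (c : triv k (AlgA k)) :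
    (rightUnit X).hom (tmul X _ x c) = trivEquiv k c • x :=
  tensorLiftAdd_tmul (trivMul X) (trivMul_balanced X) x c

/-- The homomorphism `X → X ⊗ k`, `x ↦ x ⊗ 1`. -/
noncomputable def rightUnitInv (X : ModuleCat.{u} (AlgA k)) :
    X ⟶ (tensorFunctor k (triv k (AlgA k))).obj X :=
  ModuleCat.ofHom (X := X) (Y := (tensorFunctor k (triv k (AlgA k))).obj X) <|
    AlgA.linearMapOfGenerators ((tmul X (triv k (AlgA k))).flip ((trivEquiv k).symm 1))
      (fun c x => by
        refine Eq.trans ?_ (algebraMap_smul_tmul c x _).symm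
        exact TensorProduct.smul_tmul c x _)
      (fun i x => by
        refine Eq.trans ?_ (y_smul_tmul i x _).symm
        rw [y_smul_triv, g_smul_triv, map_zero, zero_add]
        rfl)
      (fun x => by
        refine Eq.trans ?_ (g_smul_tmul x _).symm
        rw [g_smul_triv]
        rfl)

theorem rightUnitInv_rightUnit (X : ModuleCat.{u} (AlgA k)) :
    rightUnitInv X ≫ rightUnit X = 𝟙 X := by
  ext x
  refine (rightUnit_tmul X x ((trivEquiv k).symm 1)).trans ?_
  rw [LinearEquiv.apply_symm_apply, one_smul]
  rfl

/-- X is a retract of X ⊗ k. Taking M = k in `projective_tensor_B` then makes B itself projective.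
-/
theorem projective_of_projective_tensor (X : ModuleCat.{u} (AlgA k))
    (h : Projective ((tensorFunctor k (triv k (AlgA k))).obj X)) : Projective X :=
  Retract.projective ⟨rightUnitInv X, rightUnit X, rightUnitInv_rightUnit X⟩

end BialgMod
end ExtFG

namespace ExtFG
open CategoryTheory Abelian
open scoped TensorProduct ModuleCat DirectSum

/-! ### The trivial module as a summand of S, and generation of Ext in high degrees -/

namespace Koszul
open GenRep BialgMod
variable (k : Type u) [Field k]

/-- The inclusion of the trivial module in `k ⊕ k_sgn`. -/
noncomputable def trivInl : triv k (AlgA k) ⟶ (repS k).mod :=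
  ModuleCat.ofHom (X := triv k (AlgA k)) (Y := (repS k).mod) <|
    AlgA.linearMapOfGenerators ((repS k).vec.toAddMonoidHom.comp
      ((AddMonoidHom.inl k k).comp (trivEquiv k (H := AlgA k)).toAddMonoidHom))
      (fun c x => by
        refine Eq.trans ?_ ((repS k).algebraMap_smul c (trivEquiv k x, 0)).symm
        refine (congrArg (fun c => (repS k).vec (c, 0)) ((trivEquiv k).map_smul c x)).trans ?_
        simp)
      (fun i x => by
        refine Eq.trans ?_ ((repS k).y_smul i (trivEquiv k x, 0)).symm
        exact congrArg (fun c => (repS k).vec (trivEquiv k c, 0)) (y_smul_triv i x))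
      (fun x => by
        refine Eq.trans ?_ ((repS k).g_smul (trivEquiv k x, 0)).symm
        refine (congrArg (fun c => (repS k).vec (trivEquiv k c, 0)) (g_smul_triv x)).trans ?_
        exact congrArg (repS k).vec (Prod.ext rfl neg_zero.symm))

/-- The projection of `k ⊕ k_sgn` to the trivial module. -/
noncomputable def trivFst : (repS k).mod ⟶ triv k (AlgA k) :=
  ModuleCat.ofHom (X := (repS k).mod) (Y := triv k (AlgA k)) <|
    AlgA.linearMapOfGenerators (((trivEquiv k (H := AlgA k)).symm.toAddMonoidHom.comp
      (AddMonoidHom.fst k k)).comp (repS k).vec.symm.toAddMonoidHom)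
      (fun c x => by
        obtain ⟨v, rfl⟩ := (repS k).vec.surjective x
        refine (congrArg (fun x => (trivEquiv k (H := AlgA k)).symm ((repS k).vec.symm x).1)
          ((repS k).algebraMap_smul c v)).trans ?_
        exact (trivEquiv k (H := AlgA k)).symm.map_smul c v.1)
      (fun i x => by
        obtain ⟨v, rfl⟩ := (repS k).vec.surjective x
        exact (congrArg (fun x => (trivEquiv k (H := AlgA k)).symm ((repS k).vec.symm x).1)
          ((repS k).y_smul i v)).trans (y_smul_triv i _).symm)
      (fun x => by
        obtain ⟨v, rfl⟩ := (repS k).vec.surjective x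
        exact (congrArg (fun x => (trivEquiv k (H := AlgA k)).symm ((repS k).vec.symm x).1)
          ((repS k).g_smul v)).trans (g_smul_triv _).symm)

theorem trivInl_trivFst : trivInl k ≫ trivFst k = 𝟙 _ := rfl

theorem trivFst_trivInl : trivFst k ≫ trivInl k = idem 0 := hom_ext fun _ => rfl

/-- The polynomial generators of degree two of `Ext*(k, k)`. -/
noncomputable def eta (j : Fin 2) : Ext (triv k (AlgA k)) (triv k (AlgA k)) 2 :=
  sqClass (trivInl k) (trivFst k) (x k j)

variable {k}

/-- The untensored version. It gives generation by actual Yoneda multiplication with the ηⱼ, as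
needed for the algebra Ext*(k,k), without identifying `psi` for the trivial module. -/
theorem ext_triv_finite_and_generated (hk : ringChar k ≠ 2) (N : ModuleCat.{u} (AlgA k))
    (hN : Module.Finite (AlgA k) N) :
    (∀ n, Module.Finite k (Ext (triv k (AlgA k)) N n)) ∧
      ∃ n₀, ∀ n ≥ n₀, ∀ t : Ext (triv k (AlgA k)) N (n + 2), ∃ a b : Ext (triv k (AlgA k)) N n,
        t = (eta k 0).comp a (add_comm 2 n) + (eta k 1).comp b (add_comm 2 n) := by
  have := projective_of_projective_tensor _ (projective_tensor_B hk (triv k (AlgA k)))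
  exact ext_finite_and_generated k (trivInl k) (trivFst k) (trivInl_trivFst k)
    (shortExact_E 0) shortExact_B (x k 1) x_comm headE_comp_x
    (by rw [trivFst_trivInl]; exact idem_comp_sq 0) (by rw [trivFst_trivInl]; exact idem_comp_sq 1)
    N (fun _ t => t.eq_zero_of_projective)
    (AlgA.finite_hom _ _ (finite_mod _) (AlgA.finite_restrict N hN))

theorem ext_tensor_finite_and_generated (hk : ringChar k ≠ 2) (M N : ModuleCat.{u} (AlgA k))
    (hM : Module.Finite (AlgA k) M) (hN : Module.Finite (AlgA k) N) :
    (∀ n, Module.Finite k (Ext ((tensorFunctor k M).obj (triv k (AlgA k))) N n)) ∧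
      ∃ n₀, ∀ n ≥ n₀, ∀ t : Ext ((tensorFunctor k M).obj (triv k (AlgA k))) N (n + 2),
        ∃ a b : Ext ((tensorFunctor k M).obj (triv k (AlgA k))) N n,
          t = ((eta k 0).mapExactFunctor (tensorFunctor k M)).comp a (add_comm 2 n) +
            ((eta k 1).mapExactFunctor (tensorFunctor k M)).comp b (add_comm 2 n) := by
  have := projective_tensor_B hk M
  exact ext_map_finite_and_generated k (tensorFunctor k M) (trivInl k) (trivFst k)
    (trivInl_trivFst k) (shortExact_E 0) shortExact_B (x k 1) x_comm headE_comp_x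
    (by rw [trivFst_trivInl]; exact idem_comp_sq 0) (by rw [trivFst_trivInl]; exact idem_comp_sq 1)
    N (fun _ t => t.eq_zero_of_projective)
    (AlgA.finite_hom _ _ (finite_tensor _ _ (finite_mod _) (AlgA.finite_restrict M hM))
      (AlgA.finite_restrict N hN))

/-- By definition `psi` is the functorial image conjugated by k ⊗ M ≅ M, so the tensored statement
transports along this isomorphism. -/
theorem ext_finite_and_psi_generated (hk : ringChar k ≠ 2) (M N : ModuleCat.{u} (AlgA k))
    (hM : Module.Finite (AlgA k) M) (hN : Module.Finite (AlgA k) N) :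
    (∀ n, Module.Finite k (Ext M N n)) ∧
      ∃ n₀, ∀ n ≥ n₀, ∀ t : Ext M N (n + 2), ∃ a b : Ext M N n,
        t = (psi k M 2 (eta k 0)).comp a (add_comm 2 n) +
          (psi k M 2 (eta k 1)).comp b (add_comm 2 n) := by
  obtain ⟨hfin, n₀, h⟩ := ext_tensor_finite_and_generated hk M N hM hN
  have h1 : ∀ n (t : Ext M N n), (Ext.mk₀ (lidIso k M).inv).comp
      ((Ext.mk₀ (lidIso k M).hom).comp t (zero_add n)) (zero_add n) = t := fun n t => by
    rw [Ext.mk₀_comp_mk₀_assoc, Iso.inv_hom_id, Ext.mk₀_id_comp]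
  have h2 : ∀ n (t : Ext ((tensorFunctor k M).obj (triv k (AlgA k))) N n),
      (Ext.mk₀ (lidIso k M).hom).comp
      ((Ext.mk₀ (lidIso k M).inv).comp t (zero_add n)) (zero_add n) = t := fun n t => by
    rw [Ext.mk₀_comp_mk₀_assoc, Iso.hom_inv_id, Ext.mk₀_id_comp]
  refine ⟨fun n => Module.Finite.of_surjective
    (extPrecomp k (Ext.mk₀ (lidIso k M).inv) N (zero_add n)) fun t => ⟨_, h1 n t⟩,
    n₀, fun n hn t => ?_⟩
  obtain ⟨a, b, hab⟩ := h n hn ((Ext.mk₀ (lidIso k M).hom).comp t (zero_add (n + 2)))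
  have key : ∀ (ζ : Ext (triv k (AlgA k)) (triv k (AlgA k)) 2)
      (a : Ext ((tensorFunctor k M).obj (triv k (AlgA k))) N n),
      (psi k M 2 ζ).comp ((Ext.mk₀ (lidIso k M).inv).comp a (zero_add n)) (add_comm 2 n) =
      (Ext.mk₀ (lidIso k M).inv).comp ((ζ.mapExactFunctor (tensorFunctor k M)).comp a
        (add_comm 2 n)) (zero_add (n + 2)) := fun ζ a => by
    rw [psi, Ext.comp_assoc _ _ _ (zero_add 2) (add_comm 2 n) (by omega : 0 + 2 + n = n + 2),
      Ext.comp_assoc _ _ _ (add_zero 2) (zero_add n) (by omega : 2 + 0 + n = n + 2), h2]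
  exact ⟨_, _, by rw [key, key, ← Ext.comp_add, ← hab, h1]⟩

end Koszul

/-! ### From generation in high degrees to finite generation -/

section Assembly
open BialgMod Koszul
variable {k : Type u} [Field k]

theorem of_mul_of_eq {a b n : ℕ} (h : a + b = n)
    (ζ : Ext (triv k (AlgA k)) (triv k (AlgA k)) a)
    (ξ : Ext (triv k (AlgA k)) (triv k (AlgA k)) b) :
    (DirectSum.of (fun n : ℕ => Ext (triv k (AlgA k)) (triv k (AlgA k)) n) n (ζ.comp ξ h) :
      ExtAlg k (AlgA k)) = DirectSum.of _ a ζ * DirectSum.of _ b ξ := by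
  subst h
  exact (DirectSum.of_mul_of ζ ξ).symm

/-- The homogeneous element of `Ext*(M, N)` given by a class. -/
noncomputable def ofExt (M N : ModuleCat.{u} (AlgA k)) (n : ℕ) : Ext M N n →+ ExtMod M N :=
  DirectSum.of (fun n : ℕ => Ext M N n) n

theorem ofExt_psi_comp (M N : ModuleCat.{u} (AlgA k)) {a b n : ℕ} (h : a + b = n)
    (ζ : Ext (triv k (AlgA k)) (triv k (AlgA k)) a) (α : Ext M N b) :
    ofExt M N n ((psi k M a ζ).comp α h) =
      (DirectSum.of (fun n : ℕ => Ext (triv k (AlgA k)) (triv k (AlgA k)) n) a ζ :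
        ExtAlg k (AlgA k)) • ofExt M N b α := by
  subst h
  exact (of_smul_of k M N ζ α).symm

theorem psi_smul_one (M : ModuleCat.{u} (AlgA k)) (c : k) :
    psi k M 0 (c • Ext.mk₀ (𝟙 (triv k (AlgA k)))) = c • Ext.mk₀ (𝟙 M) := by
  have h : (tensorFunctor k M).map (c • 𝟙 (triv k (AlgA k))) = c • 𝟙 _ :=
    tensor_hom_ext fun x m =>
      (TensorProduct.smul_tmul c x m).trans (algebraMap_smul_tmul c x m).symm
  rw [← Ext.mk₀_smul, psi, Ext.mapExactFunctor_mk₀, h, Ext.mk₀_comp_mk₀, Ext.mk₀_comp_mk₀,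
    ← Ext.mk₀_smul]
  simp

/-- Scalars of k act through the degree-zero part of Ext*(k,k), so spans over that ring absorb
k-linear combinations in each degree. -/
theorem ofExt_smul (M N : ModuleCat.{u} (AlgA k)) (n : ℕ) (c : k) (α : Ext M N n) :
    ofExt M N n (c • α) = (DirectSum.of (fun n : ℕ => Ext (triv k (AlgA k)) (triv k (AlgA k)) n) 0
      (c • Ext.mk₀ (𝟙 (triv k (AlgA k)))) : ExtAlg k (AlgA k)) • ofExt M N n α := by
  rw [← ofExt_psi_comp M N (zero_add n), psi_smul_one, Ext.smul_comp, Ext.mk₀_id_comp]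

theorem finite_extMod (hk : ringChar k ≠ 2) (M N : ModuleCat.{u} (AlgA k))
    (hM : Module.Finite (AlgA k) M) (hN : Module.Finite (AlgA k) N) :
    Module.Finite (ExtAlg k (AlgA k)) (ExtMod M N) := by
  obtain ⟨hfin, n₀, h⟩ := ext_finite_and_psi_generated hk M N hM hN
  choose G hG using fun n => (hfin n).fg_top
  -- Spanning sets in the degrees below n₀ + 2; from there on the ηⱼ reduce the degree by two.
  let S : Set (ExtMod M N) := ⋃ n ∈ Finset.range (n₀ + 2), ofExt M N n '' (G n)
  have hS : S.Finite := Set.Finite.biUnion (Finset.finite_toSet _)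
    fun n _ => (G n).finite_toSet.image _
  have key : ∀ n (t : Ext M N n), ofExt M N n t ∈ Submodule.span (ExtAlg k (AlgA k)) S := by
    intro n
    induction n using Nat.strong_induction_on with
    | _ n ih =>
      intro t
      by_cases hn : n < n₀ + 2
      · have ht : t ∈ Submodule.span k (G n : Set (Ext M N n)) := by rw [hG]; trivial
        induction ht using Submodule.span_induction with
        | mem t ht =>
          exact Submodule.subset_span (Set.mem_biUnion (Finset.mem_coe.2 (Finset.mem_range.2 hn))
            ⟨t, ht, rfl⟩)
        | zero => rw [map_zero]; exact Submodule.zero_mem _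
        | add s t _ _ hs ht => rw [map_add]; exact Submodule.add_mem _ hs ht
        | smul c t _ ht => rw [ofExt_smul]; exact Submodule.smul_mem _ _ ht
      · obtain ⟨m, rfl⟩ : ∃ m, n = m + 2 := ⟨n - 2, by omega⟩
        obtain ⟨a, b, rfl⟩ := h m (by omega) t
        rw [map_add, ofExt_psi_comp, ofExt_psi_comp]
        exact Submodule.add_mem _ (Submodule.smul_mem _ _ (ih m (by omega) a))
          (Submodule.smul_mem _ _ (ih m (by omega) b))
  rw [Module.finite_def]
  refine Submodule.fg_def.2 ⟨S, hS, eq_top_iff.2 fun t ht => ?_⟩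
  clear ht
  change (⨁ n : ℕ, Ext M N n) at t
  induction t using DirectSum.induction_on with
  | zero => exact Submodule.zero_mem _
  | of n t => exact key n t
  | add s t hs ht => exact Submodule.add_mem _ hs ht

theorem finiteType_extAlg (hk : ringChar k ≠ 2) :
    Algebra.FiniteType k (ExtAlg k (AlgA k)) := by
  have hT : Module.Finite (AlgA k) (triv k (AlgA k)) :=
    Module.Finite.of_surjective
      (LinearMap.toSpanSingleton (AlgA k) (triv k (AlgA k)) ((trivEquiv k).symm 1)) fun x =>
        ⟨algebraMap k (AlgA k) (trivEquiv k x), by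
          apply (trivEquiv k).injective
          rw [LinearMap.toSpanSingleton_apply, trivEquiv_smul,
            Bialgebra.counit_algebraMap]
          simp⟩
  obtain ⟨hfin, n₀, h⟩ := ext_triv_finite_and_generated hk (triv k (AlgA k)) hT
  choose G hG using fun n => (hfin n).fg_top
  let e : ∀ n, Ext (triv k (AlgA k)) (triv k (AlgA k)) n →ₗ[k] ExtAlg k (AlgA k) :=
    fun n => DirectSum.lof k ℕ (fun n : ℕ => Ext (triv k (AlgA k)) (triv k (AlgA k)) n) n
  -- For algebra generators the two classes ηⱼ must be added, since they are the coefficients in the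
  -- degree reduction.
  let S : Set (ExtAlg k (AlgA k)) :=
    (⋃ n ∈ Finset.range (n₀ + 2), e n '' (G n)) ∪ Set.range fun j => e 2 (eta k j)
  have hS : S.Finite := (Set.Finite.biUnion (Finset.finite_toSet _)
    fun n _ => (G n).finite_toSet.image _).union (Set.finite_range _)
  have heta : ∀ j, e 2 (eta k j) ∈ Algebra.adjoin k S := fun j =>
    Algebra.subset_adjoin (Or.inr ⟨j, rfl⟩)
  have key : ∀ n t, e n t ∈ Algebra.adjoin k S := by
    intro n
    induction n using Nat.strong_induction_on with
    | _ n ih =>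
      intro t
      by_cases hn : n < n₀ + 2
      · have ht : t ∈ Submodule.span k (G n : Set (Ext _ _ n)) := by rw [hG]; trivial
        induction ht using Submodule.span_induction with
        | mem t ht =>
          exact Algebra.subset_adjoin (Or.inl (Set.mem_biUnion
            (Finset.mem_coe.2 (Finset.mem_range.2 hn)) ⟨t, ht, rfl⟩))
        | zero => rw [map_zero]; exact Subalgebra.zero_mem _
        | add s t _ _ hs ht => rw [map_add]; exact Subalgebra.add_mem _ hs ht
        | smul c t _ ht => rw [map_smul]; exact Subalgebra.smul_mem _ ht c
      · obtain ⟨m, rfl⟩ : ∃ m, n = m + 2 := ⟨n - 2, by omega⟩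
        obtain ⟨a, b, rfl⟩ := h m (by omega) t
        have hm : ∀ j a, e (m + 2) ((eta k j).comp a (add_comm 2 m)) = e 2 (eta k j) * e m a :=
          fun j a => of_mul_of_eq (add_comm 2 m) _ _
        rw [map_add, hm, hm]
        exact Subalgebra.add_mem _ (Subalgebra.mul_mem _ (heta 0) (ih m (by omega) a))
          (Subalgebra.mul_mem _ (heta 1) (ih m (by omega) b))
  refine ⟨Subalgebra.fg_def.2 ⟨S, hS, eq_top_iff.2 fun t ht => ?_⟩⟩
  clear ht
  induction t using DirectSum.induction_on with
  | zero => exact Subalgebra.zero_mem _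
  | of n t => exact key n t
  | add s t hs ht => exact Subalgebra.add_mem _ hs ht

end Assembly
end ExtFG

theorem mainTheorem7 (k : Type u) [Field k] (hk : ringChar k ≠ 2) :
    Algebra.FiniteType k (ExtFG.BialgMod.ExtAlg k (ExtFG.AlgA k)) ∧
      ∀ M N : ModuleCat.{u} (ExtFG.AlgA k),
        Module.Finite (ExtFG.AlgA k) M → Module.Finite (ExtFG.AlgA k) N →
          Module.Finite (ExtFG.BialgMod.ExtAlg k (ExtFG.AlgA k)) (ExtFG.BialgMod.ExtMod M N) :=
  ⟨ExtFG.finiteType_extAlg hk, ExtFG.finite_extMod hk⟩
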